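/- Let $R=R_0\oplus R_1$ be a supercommutative superring, i.e. a unital associative $\mathbb{Z}_2$-graded ring with $rs=(-1)^{|r||s|}sr$ for homogeneous $r,s$. A unital $R$-superalgebra is a unital associative $\mathbb{Z}_2$-graded ring $A$ with an even unital ring homomorphism $R\to A$ such that $ra=(-1)^{|r||a|}ar$ for homogeneous $r\in R$, $a\in A$. If $A,B$ are $R$-superalgebras, an $A$-$B$-superbimodule is a $\mathbb{Z}_2$-graded $A$-$B$-bimodule $P$ (with graded unital actions) such that $rp=(-1)^{|r||p|}pr$ for homogeneous $r\in R$, $p\in P$; isomorphisms of superbimodules are bijective, additive, linear for both actions and parity preserving. Tensor products carry the grading $|p\otimes q|=|p|+|q|$. The Hochschild chains of $A$ are $C_m(A)=A\otimes_R\cdots\otimes_R A$ ($m+1$ factors), graded by $|a_0\otimes\cdots\otimes a_m|=|a_0|+\cdots+|a_m|$ and with $R$ acting on the left factor; the differential $d:C_m(A)\to C_{m-1}(A)$, $m\ge 1$, is $$d(a_0\otimes\cdots\otimes a_m)=\sum_{i=0}^{m-1}(-1)^i a_0\otimes\cdots\otimes a_ia_{i+1}\otimes\cdots\otimes a_m+(-1)^{m+|a_m|(|a_0|+\cdots+|a_{m-1}|)}a_ma_0\otimes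 a_1\otimes\cdots\otimes a_{m-1}$$ for homogeneous $a_0,\dots,a_m$. It is even and $R$-linear, and $H_n(A)$ is the $n$-th homology of this complex, a $\mathbb{Z}_2$-graded $R$-module. **Corollary.** Let $A$ and $B$ be unital $R$-superalgebras which are Morita equivalent: there are an $A$-$B$-superbimodule $P$ and a $B$-$A$-superbimodule $Q$ such that $P\otimes_B Q\cong A$ as $A$-$A$-superbimodules and $Q\otimes_A P\cong B$ as $B$-$B$-superbimodules. Then for every $n\ge 0$ there is a parity-preserving $R$-linear isomorphism $H_n(A)\cong H_n(B)$. -/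

import Mathlib

open scoped TensorProduct
open MulOpposite

universe w w₁ w₂

noncomputable section

/-! ### Superrings, superalgebras and superbimodules -/

/-- The Koszul sign `(-1)^{ij}` for parities `i j : ZMod 2`. -/
def superSign (i j : ZMod 2) : ℤ := if i = 1 ∧ j = 1 then -1 else 1

/-- A `ℤ/2`-graded ring is supercommutative (graded commutative) if
`r s = (-1)^{|r||s|} s r` for homogeneous `r, s`. -/
def IsSupercommutative {R : Type*} [Ring R] (𝓡 : ZMod 2 → AddSubgroup R) : Prop :=
  ∀ ⦃i j : ZMod 2⦄ ⦃r s : R⦄, r ∈ 𝓡 i → s ∈ 𝓡 j → r * s = superSign i j • (s * r)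

/-- The structure of a (unital, associative) superalgebra over the superring `R` on the
`ℤ/2`-graded ring `A`: an even unital ring homomorphism from `R` to `A` whose image lies in the
supercentre of `A`. -/
structure Superalgebra {R : Type*} [Ring R] (𝓡 : ZMod 2 → AddSubgroup R)
    {A : Type*} [Ring A] (𝓐 : ZMod 2 → AddSubgroup A) [GradedRing 𝓐] where
  /-- The structure map. -/
  toRingHom : R →+* A
  map_mem : ∀ ⦃i : ZMod 2⦄ ⦃r : R⦄, r ∈ 𝓡 i → toRingHom r ∈ 𝓐 i
  supercentral : ∀ ⦃i j : ZMod 2⦄ ⦃r : R⦄ ⦃a : A⦄, r ∈ 𝓡 i → a ∈ 𝓐 j →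
    toRingHom r * a = superSign i j • (a * toRingHom r)

/-- An `A`-`B`-superbimodule over `R`: a `ℤ/2`-graded abelian group with commuting graded unital
actions of `A` on the left and of `B` on the right (that is, of `Bᵐᵒᵖ` on the left), such that
the two induced actions of `R` agree up to the Koszul sign: `r p = (-1)^{|r||p|} p r`. -/
structure SuperBimodule {R : Type*} [Ring R] {𝓡 : ZMod 2 → AddSubgroup R}
    {A : Type*} [Ring A] {𝓐 : ZMod 2 → AddSubgroup A} [GradedRing 𝓐]
    {B : Type*} [Ring B] {𝓑 : ZMod 2 → AddSubgroup B} [GradedRing 𝓑]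
    (SA : Superalgebra 𝓡 𝓐) (SB : Superalgebra 𝓡 𝓑) where
  /-- The underlying abelian group. -/
  carrier : Type w
  [addCommGroup : AddCommGroup carrier]
  [leftModule : Module A carrier]
  [rightModule : Module Bᵐᵒᵖ carrier]
  [smulCommClass : SMulCommClass A Bᵐᵒᵖ carrier]
  /-- The homogeneous parts. -/
  grading : ZMod 2 → AddSubgroup carrier
  isInternal : DirectSum.IsInternal grading
  smul_mem : ∀ ⦃i j : ZMod 2⦄ ⦃a : A⦄ ⦃p : carrier⦄,
    a ∈ 𝓐 i → p ∈ grading j → a • p ∈ grading (i + j)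
  op_smul_mem : ∀ ⦃i j : ZMod 2⦄ ⦃p : carrier⦄ ⦃b : B⦄,
    p ∈ grading i → b ∈ 𝓑 j → op b • p ∈ grading (i + j)
  base_smul : ∀ ⦃i j : ZMod 2⦄ ⦃r : R⦄ ⦃p : carrier⦄, r ∈ 𝓡 i → p ∈ grading j →
    SA.toRingHom r • p = superSign i j • (op (SB.toRingHom r) • p)

attribute [instance] SuperBimodule.addCommGroup SuperBimodule.leftModule
  SuperBimodule.rightModule SuperBimodule.smulCommClass

/-! ### Helper facts on gradings and quotients -/

theorem superSign_add_right (i j k : ZMod 2) :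
    superSign i (j + k) = superSign i j * superSign i k := by
  revert i j k; decide

theorem superSign_add_left (i j k : ZMod 2) :
    superSign (i + j) k = superSign i k * superSign j k := by
  revert i j k; decide

theorem superSign_mul_self (i j : ZMod 2) : superSign i j * superSign i j = 1 := by
  revert i j; decide

theorem superSign_comm (i j : ZMod 2) : superSign i j = superSign j i := by
  revert i j; decide

theorem add_eq_iff_eq_add_mod_two (k i l : ZMod 2) : k + i = l ↔ k = i + l := by
  revert k i l; decide

theorem isInternal_of_proj {M : Type*} [AddCommGroup M] (G : ZMod 2 → AddSubgroup M)
    (π : ZMod 2 → M →+ M) (hmem : ∀ k x, π k x ∈ G k) (hsum : ∀ x, ∑ k, π k x = x)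
    (hπ : ∀ j k x, x ∈ G j → π k x = if k = j then x else 0) : DirectSum.IsInternal G := by
  classical
  let D : DirectSum.Decomposition G :=
    { decompose' := fun x => ∑ k, DirectSum.of (fun i => G i) k ⟨π k x, hmem k x⟩
      left_inv := fun x => by
        simp only [map_sum, DirectSum.coeAddMonoidHom_of]
        exact hsum x
      right_inv := fun y => by
        induction y using DirectSum.induction_on with
        | zero =>
          refine Finset.sum_eq_zero fun k _ => ?_
          rw [← map_zero (DirectSum.of (fun i => G i) k)]
          congr 1
          ext
          simp
        | of j y =>
          rw [DirectSum.coeAddMonoidHom_of]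
          change ∑ k, DirectSum.of (fun i => G i) k ⟨π k y, hmem k y⟩ = _
          rw [Finset.sum_eq_single j]
          · congr 1
            ext
            simp [hπ j j y y.2]
          · intro k _ hk
            rw [← map_zero (DirectSum.of (fun i => G i) k)]
            congr 1
            ext
            simp [hπ j k y y.2, hk]
          · simp
        | add x y hx hy =>
          conv_rhs => rw [← hx, ← hy]
          rw [map_add]
          change _ = ∑ k, _ + ∑ k, _
          rw [← Finset.sum_add_distrib]
          refine Finset.sum_congr rfl fun k _ => ?_
          refine (congrArg (DirectSum.of (fun i => G i) k) ?_).trans (map_add _ _ _)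
          refine Subtype.ext ?_
          simp }
  exact DirectSum.Decomposition.isInternal G

/-- A ring acting additively on `T` acts on the quotient of `T` by a stable subgroup. -/
def quotientAction {S T : Type*} [Ring S] [AddCommGroup T] (N : Submodule ℤ T)
    (φ : S →+* Module.End ℤ T) (h : ∀ s, N ≤ N.comap (φ s)) : S →+* Module.End ℤ (T ⧸ N) where
  toFun s := N.mapQ N (φ s) (h s)
  map_one' := by ext x; simp
  map_zero' := by ext x; simp
  map_mul' a b := by ext x; simp
  map_add' a b := by ext x; simp

section Tensor

variable {R : Type*} [Ring R] {𝓡 : ZMod 2 → AddSubgroup R}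
  {A : Type*} [Ring A] {𝓐 : ZMod 2 → AddSubgroup A} [GradedRing 𝓐]
  {B : Type*} [Ring B] {𝓑 : ZMod 2 → AddSubgroup B} [GradedRing 𝓑]
  {C : Type*} [Ring C] {𝓒 : ZMod 2 → AddSubgroup C} [GradedRing 𝓒]
  {SA : Superalgebra 𝓡 𝓐} {SB : Superalgebra 𝓡 𝓑} {SC : Superalgebra 𝓡 𝓒}

namespace SuperBimodule

/-- An isomorphism of superbimodules: an additive bijection which is linear for both actions and
preserves the parity. -/
structure Iso (M N : SuperBimodule SA SB) where
  /-- The underlying additive bijection. -/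
  toAddEquiv : M.carrier ≃+ N.carrier
  map_smul : ∀ (a : A) (x : M.carrier), toAddEquiv (a • x) = a • toAddEquiv x
  map_op_smul : ∀ (b : B) (x : M.carrier), toAddEquiv (op b • x) = op b • toAddEquiv x
  map_mem : ∀ ⦃i : ZMod 2⦄ ⦃x : M.carrier⦄, x ∈ M.grading i → toAddEquiv x ∈ N.grading i

/-- A superalgebra as a superbimodule over itself, by multiplication. -/
abbrev regular (SA : Superalgebra 𝓡 𝓐) : SuperBimodule SA SA where
  carrier := A
  grading := 𝓐
  isInternal := DirectSum.Decomposition.isInternal 𝓐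
  smul_mem _ _ _ _ ha hp := SetLike.mul_mem_graded ha hp
  op_smul_mem _ _ _ _ hp hb := SetLike.mul_mem_graded hp hb
  base_smul _ _ _ _ hr hp := SA.supercentral hr hp

variable (P : SuperBimodule SA SB) (Q : SuperBimodule SB SC)

/-- The relations `p b ⊗ q = p ⊗ b q` inside `P ⊗ Q` (over `ℤ`). -/
def tensorRel : Submodule ℤ (P.carrier ⊗[ℤ] Q.carrier) :=
  Submodule.span ℤ {t | ∃ (p : P.carrier) (b : B) (q : Q.carrier), t = (op b • p) ⊗ₜ[ℤ] q - p ⊗ₜ[ℤ] (b • q)}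

/-- The underlying abelian group of `P ⊗_B Q`. -/
def TensorCarrier : Type _ := (P.carrier ⊗[ℤ] Q.carrier) ⧸ tensorRel P Q

instance : AddCommGroup (TensorCarrier P Q) :=
  inferInstanceAs (AddCommGroup ((P.carrier ⊗[ℤ] Q.carrier) ⧸ tensorRel P Q))

/-- The class of `p ⊗ q` in `P ⊗_B Q`. -/
def tmul (p : P.carrier) (q : Q.carrier) : TensorCarrier P Q :=
  (tensorRel P Q).mkQ (p ⊗ₜ[ℤ] q)

/-- The left action of `A` on `P ⊗ Q` through `P`. -/
def tensorLeft : A →+* Module.End ℤ (P.carrier ⊗[ℤ] Q.carrier) where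
  toFun a := TensorProduct.map (Module.toModuleEnd ℤ P.carrier a) LinearMap.id
  map_one' := TensorProduct.ext' fun p q => congrArg (· ⊗ₜ[ℤ] q) (one_smul A p)
  map_zero' := TensorProduct.ext' fun p q =>
    (congrArg (· ⊗ₜ[ℤ] q) (zero_smul A p)).trans (TensorProduct.zero_tmul _ _)
  map_mul' a b := TensorProduct.ext' fun p q => congrArg (· ⊗ₜ[ℤ] q) (mul_smul a b p)
  map_add' a b := TensorProduct.ext' fun p q =>
    (congrArg (· ⊗ₜ[ℤ] q) (add_smul a b p)).trans (TensorProduct.add_tmul _ _ _)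

/-- The right action of `C` on `P ⊗ Q` through `Q`. -/
def tensorRight : Cᵐᵒᵖ →+* Module.End ℤ (P.carrier ⊗[ℤ] Q.carrier) where
  toFun c := TensorProduct.map LinearMap.id (Module.toModuleEnd ℤ Q.carrier c)
  map_one' := TensorProduct.ext' fun p q => congrArg (p ⊗ₜ[ℤ] ·) (one_smul Cᵐᵒᵖ q)
  map_zero' := TensorProduct.ext' fun p q =>
    (congrArg (p ⊗ₜ[ℤ] ·) (zero_smul Cᵐᵒᵖ q)).trans (TensorProduct.tmul_zero _ _)
  map_mul' a b := TensorProduct.ext' fun p q => congrArg (p ⊗ₜ[ℤ] ·) (mul_smul a b q)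
  map_add' a b := TensorProduct.ext' fun p q =>
    (congrArg (p ⊗ₜ[ℤ] ·) (add_smul a b q)).trans (TensorProduct.tmul_add _ _ _)

theorem tensorLeft_stable (a : A) :
    tensorRel P Q ≤ (tensorRel P Q).comap (tensorLeft P Q a) := by
  refine Submodule.span_le.2 ?_
  rintro _ ⟨p, b, q, rfl⟩
  refine Submodule.subset_span ⟨a • p, b, q, ?_⟩
  rw [map_sub, ← smul_comm a (op b) p]
  rfl

theorem tensorRight_stable (c : Cᵐᵒᵖ) :
    tensorRel P Q ≤ (tensorRel P Q).comap (tensorRight P Q c) := by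
  refine Submodule.span_le.2 ?_
  rintro _ ⟨p, b, q, rfl⟩
  refine Submodule.subset_span ⟨p, b, c • q, ?_⟩
  rw [map_sub, smul_comm b c q]
  rfl

instance : Module A (TensorCarrier P Q) :=
  Module.compHom ((P.carrier ⊗[ℤ] Q.carrier) ⧸ tensorRel P Q)
    (quotientAction (tensorRel P Q) (tensorLeft P Q) (tensorLeft_stable P Q))

instance : Module Cᵐᵒᵖ (TensorCarrier P Q) :=
  Module.compHom ((P.carrier ⊗[ℤ] Q.carrier) ⧸ tensorRel P Q)
    (quotientAction (tensorRel P Q) (tensorRight P Q) (tensorRight_stable P Q))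

variable {P Q}

theorem smul_tmul (a : A) (p : P.carrier) (q : Q.carrier) :
    a • tmul P Q p q = tmul P Q (a • p) q := rfl

theorem op_smul_tmul (c : Cᵐᵒᵖ) (p : P.carrier) (q : Q.carrier) :
    c • tmul P Q p q = tmul P Q p (c • q) := rfl

theorem tmul_add (p : P.carrier) (q q' : Q.carrier) :
    tmul P Q p (q + q') = tmul P Q p q + tmul P Q p q' := by
  simp only [tmul, TensorProduct.tmul_add, map_add]
  rfl

theorem add_tmul (p p' : P.carrier) (q : Q.carrier) :
    tmul P Q (p + p') q = tmul P Q p q + tmul P Q p' q := by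
  simp only [tmul, TensorProduct.add_tmul, map_add]
  rfl

theorem op_smul_tmul_eq (p : P.carrier) (b : B) (q : Q.carrier) :
    tmul P Q (op b • p) q = tmul P Q p (b • q) :=
  (Submodule.Quotient.eq _).2 (Submodule.subset_span ⟨p, b, q, rfl⟩)

@[elab_as_elim]
theorem tensor_induction {motive : TensorCarrier P Q → Prop} (x : TensorCarrier P Q)
    (zero : motive 0) (tmul : ∀ p q, motive (tmul P Q p q))
    (add : ∀ x y, motive x → motive y → motive (x + y)) : motive x := by
  obtain ⟨t, rfl⟩ := Submodule.mkQ_surjective (tensorRel P Q) x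
  induction t using TensorProduct.induction_on with
  | zero => exact zero
  | tmul p q => exact tmul p q
  | add x y hx hy => exact add _ _ hx hy

/-- Additive maps out of `P ⊗_B Q` from balanced biadditive maps. -/
def tensorLift {G : Type*} [AddCommGroup G] (f : P.carrier →+ Q.carrier →+ G)
    (hf : ∀ (p : P.carrier) (b : B) (q : Q.carrier), f (op b • p) q = f p (b • q)) : TensorCarrier P Q →+ G :=
  ((tensorRel P Q).liftQ (TensorProduct.liftAddHom f (fun r m n => by simp)).toIntLinearMap (by
    refine Submodule.span_le.2 ?_
    rintro _ ⟨p, b, q, rfl⟩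
    simp [hf])).toAddMonoidHom

theorem tensorLift_tmul {G : Type*} [AddCommGroup G] (f : P.carrier →+ Q.carrier →+ G)
    (hf : ∀ (p : P.carrier) (b : B) (q : Q.carrier), f (op b • p) q = f p (b • q)) (p : P.carrier) (q : Q.carrier) :
    tensorLift f hf (tmul P Q p q) = f p q := rfl

variable (P Q)

instance : SMulCommClass A Cᵐᵒᵖ (TensorCarrier P Q) where
  smul_comm a c x := by
    induction x using tensor_induction with
    | zero => simp
    | tmul p q => rfl
    | add x y hx hy => simp only [smul_add, hx, hy]

/-- The part of `P ⊗_B Q` of parity `k`: generated by the `p ⊗ q` with `p, q` homogeneous and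
`|p| + |q| = k`. -/
def tensorGrading (k : ZMod 2) : AddSubgroup (TensorCarrier P Q) :=
  AddSubgroup.closure {t | ∃ (i j : ZMod 2) (p : P.carrier) (q : Q.carrier),
    p ∈ P.grading i ∧ q ∈ Q.grading j ∧ i + j = k ∧ t = tmul P Q p q}

theorem tmul_mem {i j k : ZMod 2} {p : P.carrier} {q : Q.carrier} (hp : p ∈ P.grading i)
    (hq : q ∈ Q.grading j) (hk : i + j = k) : tmul P Q p q ∈ tensorGrading P Q k :=
  AddSubgroup.subset_closure ⟨i, j, p, q, hp, hq, hk, rfl⟩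

section Proj

variable (M : SuperBimodule SA SB)

/-- The projection of a superbimodule to its part of parity `k`. -/
def proj (k : ZMod 2) : M.carrier →+ M.carrier :=
  letI := M.isInternal.chooseDecomposition
  (M.grading k).subtype.comp
    ((DFinsupp.evalAddMonoidHom k).comp (DirectSum.decomposeAddEquiv M.grading).toAddMonoidHom)

theorem proj_mem (k : ZMod 2) (x : M.carrier) : M.proj k x ∈ M.grading k :=
  SetLike.coe_mem _

theorem sum_proj (x : M.carrier) : ∑ k, M.proj k x = x := by
  let _ := M.isInternal.chooseDecomposition
  classical
  conv_rhs => rw [← DirectSum.sum_support_decompose M.grading x]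
  refine (Finset.sum_subset (Finset.subset_univ _) fun k _ hk => ?_).symm
  rw [DFinsupp.notMem_support_iff] at hk
  exact congrArg Subtype.val hk

theorem proj_of_mem {j : ZMod 2} (k : ZMod 2) {x : M.carrier} (hx : x ∈ M.grading j) :
    M.proj k x = if k = j then x else 0 := by
  let _ := M.isInternal.chooseDecomposition
  change ((DirectSum.decompose M.grading x) k : M.carrier) = _
  split_ifs with h
  · subst h
    exact DirectSum.decompose_of_mem_same _ hx
  · exact DirectSum.decompose_of_mem_ne _ hx (Ne.symm h)

theorem proj_shift {j : ZMod 2} (f : M.carrier →+ M.carrier)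
    (hf : ∀ i x, x ∈ M.grading i → f x ∈ M.grading (i + j)) (k : ZMod 2) (x : M.carrier) :
    M.proj (k + j) (f x) = f (M.proj k x) := by
  conv_lhs => rw [← M.sum_proj x]
  rw [map_sum, map_sum, Finset.sum_eq_single k]
  · rw [M.proj_of_mem _ (hf _ _ (M.proj_mem k x)), if_pos rfl]
  · intro i _ hi
    rw [M.proj_of_mem _ (hf _ _ (M.proj_mem i x)), if_neg]
    exact fun h => hi (add_right_cancel h).symm
  · simp

end Proj

/-- The bilinear map underlying the projection of `P ⊗_B Q` to its part of parity `k`. -/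
def tensorProjAux (k : ZMod 2) : P.carrier →+ Q.carrier →+ TensorCarrier P Q :=
  AddMonoidHom.mk' (fun p => AddMonoidHom.mk'
    (fun q => ∑ i, tmul P Q (P.proj i p) (Q.proj (k + i) q))
    (fun q q' => by simp only [map_add, tmul_add, Finset.sum_add_distrib]))
    (fun p p' => by
      ext q
      simp only [map_add, add_tmul, Finset.sum_add_distrib, AddMonoidHom.mk'_apply,
        AddMonoidHom.add_apply])

theorem tensorProjAux_apply (k : ZMod 2) (p : P.carrier) (q : Q.carrier) :
    tensorProjAux P Q k p q = ∑ i, tmul P Q (P.proj i p) (Q.proj (k + i) q) := rfl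

theorem tensorProjAux_balanced (k : ZMod 2) (p : P.carrier) (b : B) (q : Q.carrier) :
    tensorProjAux P Q k (op b • p) q = tensorProjAux P Q k p (b • q) := by
  induction b using DirectSum.Decomposition.inductionOn 𝓑 with
  | zero => simp
  | add b b' h h' => simp only [op_add, add_smul, map_add, AddMonoidHom.add_apply, h, h']
  | @homogeneous j b =>
    simp only [tensorProjAux_apply]
    rw [← Equiv.sum_comp (Equiv.addRight j)]
    refine Finset.sum_congr rfl fun i _ => ?_
    have h1 := P.proj_shift (j := j) (DistribSMul.toAddMonoidHom P.carrier (op (b : B)))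
      (fun i x hx => P.op_smul_mem hx b.2) i p
    have h2 := Q.proj_shift (j := j) (DistribSMul.toAddMonoidHom Q.carrier (b : B))
      (fun i x hx => by
        rw [add_comm]
        exact Q.smul_mem b.2 hx) (k + i + j) q
    have h3 : k + i + j + j = k + i := by
      rw [add_assoc, CharTwo.add_self_eq_zero, add_zero]
    rw [h3] at h2
    simp only [DistribSMul.toAddMonoidHom_apply] at h1 h2
    rw [Equiv.coe_addRight, h1, h2, op_smul_tmul_eq, ← add_assoc]

/-- The tensor product `P ⊗_B Q` of an `A`-`B`-superbimodule and a `B`-`C`-superbimodule. -/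
abbrev tensor : SuperBimodule SA SC where
  carrier := TensorCarrier P Q
  grading := tensorGrading P Q
  isInternal := by
    refine isInternal_of_proj _
      (fun k => tensorLift (tensorProjAux P Q k) (tensorProjAux_balanced P Q k)) ?_ ?_ ?_
    · intro k x
      induction x using tensor_induction with
      | zero => rw [map_zero]; exact zero_mem _
      | tmul p q =>
        rw [tensorLift_tmul, tensorProjAux_apply]
        refine sum_mem fun i _ => tmul_mem P Q (P.proj_mem _ _) (Q.proj_mem _ _) ?_
        rw [add_comm, add_assoc, CharTwo.add_self_eq_zero, add_zero]
      | add x y hx hy => rw [map_add]; exact add_mem hx hy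
    · intro x
      induction x using tensor_induction with
      | zero => simp
      | tmul p q =>
        simp only [tensorLift_tmul, tensorProjAux_apply]
        rw [Finset.sum_comm]
        conv_rhs => rw [← P.sum_proj p]
        have h : ∀ i, ∑ k, tmul P Q (P.proj i p) (Q.proj (k + i) q)
            = tmul P Q (P.proj i p) q := fun i => by
          conv_rhs => rw [← Q.sum_proj q, ← Equiv.sum_comp (Equiv.addRight i)]
          exact (map_sum (AddMonoidHom.mk' (tmul P Q (P.proj i p)) (tmul_add _)) _ _).symm
        simp only [h]
        exact (map_sum (AddMonoidHom.mk' (fun p => tmul P Q p q)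
          (fun p p' => add_tmul p p' q)) _ _).symm
      | add x y hx hy => simp only [map_add, Finset.sum_add_distrib, hx, hy]
    · intro j k x hx
      induction hx using AddSubgroup.closure_induction with
      | mem x hx =>
        obtain ⟨i, l, p, q, hp, hq, rfl, rfl⟩ := hx
        rw [tensorLift_tmul, tensorProjAux_apply, Finset.sum_eq_single i]
        · rw [P.proj_of_mem _ hp, if_pos rfl, Q.proj_of_mem _ hq]
          simp only [add_eq_iff_eq_add_mod_two k i l]
          split_ifs
          · rfl
          · exact (AddMonoidHom.mk' (tmul P Q p) (tmul_add _)).map_zero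
        · intro i' _ hi'
          rw [P.proj_of_mem _ hp, if_neg hi']
          exact (AddMonoidHom.mk' (fun p => tmul P Q p (Q.proj (k + i') q))
            (fun p p' => add_tmul p p' _)).map_zero
        · simp
      | zero => simp
      | add x y _ _ hx hy => rw [map_add, hx, hy]; split_ifs <;> simp
      | neg x _ hx => rw [map_neg, hx]; split_ifs <;> simp
  smul_mem := by
    intro i j a x ha hx
    induction hx using AddSubgroup.closure_induction with
    | mem x hx =>
      obtain ⟨k, l, p, q, hp, hq, rfl, rfl⟩ := hx
      exact tmul_mem P Q (P.smul_mem ha hp) hq (add_assoc _ _ _)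
    | zero => rw [smul_zero]; exact zero_mem _
    | add x y _ _ hx hy => rw [smul_add]; exact add_mem hx hy
    | neg x _ hx => rw [smul_neg]; exact neg_mem hx
  op_smul_mem := by
    intro i j x c hx hc
    induction hx using AddSubgroup.closure_induction with
    | mem x hx =>
      obtain ⟨k, l, p, q, hp, hq, rfl, rfl⟩ := hx
      exact tmul_mem P Q hp (Q.op_smul_mem hq hc) (add_assoc _ _ _).symm
    | zero => rw [smul_zero]; exact zero_mem _
    | add x y _ _ hx hy => rw [smul_add]; exact add_mem hx hy
    | neg x _ hx => rw [smul_neg]; exact neg_mem hx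
  base_smul := by
    intro i j r x hr hx
    induction hx using AddSubgroup.closure_induction with
    | mem x hx =>
      obtain ⟨k, l, p, q, hp, hq, rfl, rfl⟩ := hx
      have e1 : ∀ (n : ℤ) (p : P.carrier), tmul P Q (n • p) q = n • tmul P Q p q := fun n p =>
        (AddMonoidHom.mk' (fun p => tmul P Q p q) (fun p p' => add_tmul p p' q)).map_zsmul n p
      have e2 : ∀ (n : ℤ) (q : Q.carrier), tmul P Q p (n • q) = n • tmul P Q p q := fun n q =>
        (AddMonoidHom.mk' (tmul P Q p) (tmul_add p)).map_zsmul n q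
      rw [smul_tmul, op_smul_tmul, P.base_smul hr hp, e1, op_smul_tmul_eq, Q.base_smul hr hq, e2,
        smul_smul, superSign_add_right]
    | zero => simp
    | add x y _ _ hx hy => rw [smul_add, smul_add, smul_add, hx, hy]
    | neg x _ hx => rw [smul_neg, smul_neg, smul_neg, hx]

end SuperBimodule

/-- Two unital `R`-superalgebras `A` and `B` are Morita equivalent if there are an
`A`-`B`-superbimodule `P` and a `B`-`A`-superbimodule `Q` with `P ⊗_B Q ≅ A` as
`A`-`A`-superbimodules and `Q ⊗_A P ≅ B` as `B`-`B`-superbimodules. -/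
def SuperMoritaEquivalent (SA : Superalgebra 𝓡 𝓐) (SB : Superalgebra 𝓡 𝓑) : Prop :=
  ∃ (P : SuperBimodule.{w₁} SA SB) (Q : SuperBimodule.{w₂} SB SA),
    Nonempty ((P.tensor Q).Iso (SuperBimodule.regular SA)) ∧
    Nonempty ((Q.tensor P).Iso (SuperBimodule.regular SB))

end Tensor

/-! ### The Hochschild complex of a superalgebra -/

section Hochschild

variable {R : Type*} [Ring R] {𝓡 : ZMod 2 → AddSubgroup R}
  {A : Type*} [Ring A] {𝓐 : ZMod 2 → AddSubgroup A} [GradedRing 𝓐]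

/-- The additive map `a ↦ (-1)^{p|a|} a` on a `ℤ/2`-graded ring. -/
def superTwist (𝓐 : ZMod 2 → AddSubgroup A) [GradedRing 𝓐] (p : ZMod 2) : A →+ A :=
  ∑ i, superSign p i • GradedRing.proj 𝓐 i

theorem gradedRing_proj_of_mem {j : ZMod 2} (k : ZMod 2) {a : A} (ha : a ∈ 𝓐 j) :
    GradedRing.proj 𝓐 k a = if k = j then a else 0 := by
  rw [GradedRing.proj_apply]
  split_ifs with h
  · subst h
    exact DirectSum.decompose_of_mem_same _ ha
  · exact DirectSum.decompose_of_mem_ne _ ha (Ne.symm h)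

theorem superTwist_of_mem (p : ZMod 2) {i : ZMod 2} {a : A} (ha : a ∈ 𝓐 i) :
    superTwist 𝓐 p a = superSign p i • a := by
  rw [superTwist, AddMonoidHom.finsetSum_apply, Finset.sum_eq_single i]
  · rw [AddMonoidHom.smul_apply, gradedRing_proj_of_mem _ ha, if_pos rfl]
  · intro k _ hk
    rw [AddMonoidHom.smul_apply, gradedRing_proj_of_mem _ ha, if_neg hk, smul_zero]
  · simp

theorem superTwist_mem (p : ZMod 2) {i : ZMod 2} {a : A} (ha : a ∈ 𝓐 i) :
    superTwist 𝓐 p a ∈ 𝓐 i := by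
  rw [superTwist_of_mem p ha]
  exact zsmul_mem ha _

theorem superTwist_mul (p : ZMod 2) (a b : A) :
    superTwist 𝓐 p (a * b) = superTwist 𝓐 p a * superTwist 𝓐 p b := by
  induction a using DirectSum.Decomposition.inductionOn 𝓐 with
  | zero => simp
  | add a a' h h' => rw [add_mul, map_add, h, h', map_add, add_mul]
  | homogeneous a =>
    induction b using DirectSum.Decomposition.inductionOn 𝓐 with
    | zero => simp
    | add a a' h h' => rw [mul_add, map_add, h, h', map_add, mul_add]
    | homogeneous b =>
      rw [superTwist_of_mem p (SetLike.mul_mem_graded a.2 b.2), superTwist_of_mem p a.2,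
        superTwist_of_mem p b.2, superSign_add_right, smul_mul_smul_comm]

/-- A map between spaces of tuples which, in each slot separately, is an additive map into one
slot induces a multilinear map to the tensor power over `ℤ`. -/
def slotMultilinear {m n : ℕ} (F : (Fin m → A) → Fin n → A)
    (hF : ∀ a k, ∃ (l : Fin n) (g : A →+ A), ∀ x,
      F (Function.update a k x) = Function.update (F a) l (g x)) :
    MultilinearMap ℤ (fun _ : Fin m => A) (⨂[ℤ] _ : Fin n, A) where
  toFun a := PiTensorProduct.tprod ℤ (F a)
  map_update_add' {inst} a k x y := by
    obtain rfl : inst = instDecidableEqFin m := Subsingleton.elim _ _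
    obtain ⟨l, g, h⟩ := hF a k
    rw [h, h, h, map_add, MultilinearMap.map_update_add]
  map_update_smul' {inst} a k c x := by
    obtain rfl : inst = instDecidableEqFin m := Subsingleton.elim _ _
    obtain ⟨l, g, h⟩ := hF a k
    rw [h, h, map_zsmul, MultilinearMap.map_update_smul]

/-- `(a₀, …, a_{m+1}) ↦ (a₀, …, a_i a_{i+1}, …, a_{m+1})`. -/
def faceTuple {m : ℕ} (i : Fin (m + 1)) (a : Fin (m + 2) → A) : Fin (m + 1) → A :=
  Fin.contractNth i.castSucc (· * ·) a

theorem faceTuple_apply {m : ℕ} (i : Fin (m + 1)) (a : Fin (m + 2) → A) (j : Fin (m + 1)) :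
    faceTuple i a j = if j < i then a j.castSucc
      else if j = i then a j.castSucc * a j.succ else a j.succ := by
  simp only [faceTuple, Fin.contractNth, Fin.val_castSucc, Fin.lt_def, Fin.ext_iff]

theorem faceTuple_update_castSucc_lt {m : ℕ} {i l : Fin (m + 1)} (h : l < i)
    (a : Fin (m + 2) → A) (x : A) :
    faceTuple i (Function.update a l.castSucc x) = Function.update (faceTuple i a) l x := by
  ext j
  simp only [faceTuple_apply, Function.update_apply, Fin.lt_def, Fin.ext_iff, Fin.val_castSucc,
    Fin.val_succ] at h ⊢
  grind

theorem faceTuple_update_castSucc_self {m : ℕ} (i : Fin (m + 1)) (a : Fin (m + 2) → A) (x : A) :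
    faceTuple i (Function.update a i.castSucc x)
      = Function.update (faceTuple i a) i (x * a i.succ) := by
  ext j
  simp only [faceTuple_apply, Function.update_apply, Fin.lt_def, Fin.ext_iff, Fin.val_castSucc,
    Fin.val_succ]
  grind

theorem faceTuple_update_succ_self {m : ℕ} (i : Fin (m + 1)) (a : Fin (m + 2) → A) (x : A) :
    faceTuple i (Function.update a i.succ x)
      = Function.update (faceTuple i a) i (a i.castSucc * x) := by
  ext j
  simp only [faceTuple_apply, Function.update_apply, Fin.lt_def, Fin.ext_iff, Fin.val_castSucc,
    Fin.val_succ]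
  grind

theorem faceTuple_update_succ_gt {m : ℕ} {i l : Fin (m + 1)} (h : i < l)
    (a : Fin (m + 2) → A) (x : A) :
    faceTuple i (Function.update a l.succ x) = Function.update (faceTuple i a) l x := by
  ext j
  simp only [faceTuple_apply, Function.update_apply, Fin.lt_def, Fin.ext_iff, Fin.val_castSucc,
    Fin.val_succ] at h ⊢
  grind

theorem faceTuple_slot {m : ℕ} (i : Fin (m + 1)) (a : Fin (m + 2) → A) (k : Fin (m + 2)) :
    ∃ (l : Fin (m + 1)) (g : A →+ A), ∀ x,
      faceTuple i (Function.update a k x) = Function.update (faceTuple i a) l (g x) := by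
  rcases lt_trichotomy k i.castSucc with h | rfl | h
  · obtain ⟨l, rfl⟩ : ∃ l : Fin (m + 1), l.castSucc = k :=
      Fin.exists_castSucc_eq.2 (ne_of_lt (h.trans_le (Fin.le_last _)))
    exact ⟨l, AddMonoidHom.id A, faceTuple_update_castSucc_lt (by simpa using h) a⟩
  · exact ⟨i, AddMonoidHom.mulRight (a i.succ), faceTuple_update_castSucc_self i a⟩
  · obtain ⟨l, rfl⟩ := Fin.exists_succ_eq.2 (show k ≠ 0 from fun h0 => by simp [h0] at h)
    rcases eq_or_lt_of_le (Fin.castSucc_lt_succ_iff.1 h)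
      with rfl | h'
    · exact ⟨i, AddMonoidHom.mulLeft (a i.castSucc), faceTuple_update_succ_self i a⟩
    · exact ⟨l, AddMonoidHom.id A, faceTuple_update_succ_gt h' a⟩

/-- The face `a₀ ⊗ … ⊗ a_{m+1} ↦ a₀ ⊗ … ⊗ a_i a_{i+1} ⊗ … ⊗ a_{m+1}`, `i ≤ m`, on tensor powers
over `ℤ`. -/
def face {m : ℕ} (i : Fin (m + 1)) :
    (⨂[ℤ] _ : Fin (m + 2), A) →ₗ[ℤ] ⨂[ℤ] _ : Fin (m + 1), A :=
  PiTensorProduct.lift (slotMultilinear (faceTuple i) (faceTuple_slot i))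

theorem face_tprod {m : ℕ} (i : Fin (m + 1)) (a : Fin (m + 2) → A) :
    face (A := A) i (PiTensorProduct.tprod ℤ a) = PiTensorProduct.tprod ℤ (faceTuple i a) :=
  PiTensorProduct.lift.tprod _

/-- `(a₀, …, a_{m+1}) ↦ (c a₀', a₁', …, a_m')` where `c` is the part of parity `p` of `a_{m+1}`
and `a' = (-1)^{p|a|} a`. -/
def lastFaceTuple (𝓐 : ZMod 2 → AddSubgroup A) [GradedRing 𝓐] {m : ℕ} (p : ZMod 2)
    (a : Fin (m + 2) → A) (j : Fin (m + 1)) : A :=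
  if j = 0 then GradedRing.proj 𝓐 p (a (Fin.last (m + 1))) * superTwist 𝓐 p (a 0)
  else superTwist 𝓐 p (a j.castSucc)

theorem lastFaceTuple_update_last {m : ℕ} (p : ZMod 2) (a : Fin (m + 2) → A) (x : A) :
    lastFaceTuple 𝓐 p (Function.update a (Fin.last (m + 1)) x)
      = Function.update (lastFaceTuple 𝓐 p a) 0 (GradedRing.proj 𝓐 p x * superTwist 𝓐 p (a 0)) := by
  ext j
  have h : (0 : Fin (m + 2)) ≠ Fin.last (m + 1) := (Fin.last_pos).ne
  have h' : j.castSucc ≠ Fin.last (m + 1) := (Fin.castSucc_lt_last j).ne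
  by_cases hj : j = 0 <;> simp [lastFaceTuple, Function.update_apply, h, h', hj]

theorem lastFaceTuple_update_zero {m : ℕ} (p : ZMod 2) (a : Fin (m + 2) → A) (x : A) :
    lastFaceTuple 𝓐 p (Function.update a 0 x)
      = Function.update (lastFaceTuple 𝓐 p a) 0
        (GradedRing.proj 𝓐 p (a (Fin.last (m + 1))) * superTwist 𝓐 p x) := by
  ext j
  have h : Fin.last (m + 1) ≠ (0 : Fin (m + 2)) := (Fin.last_pos).ne'
  by_cases hj : j = 0 <;> simp [lastFaceTuple, Function.update_apply, h, hj]

theorem lastFaceTuple_update_castSucc {m : ℕ} (p : ZMod 2) (a : Fin (m + 2) → A)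
    {l : Fin (m + 1)} (hl : l ≠ 0) (x : A) :
    lastFaceTuple 𝓐 p (Function.update a l.castSucc x)
      = Function.update (lastFaceTuple 𝓐 p a) l (superTwist 𝓐 p x) := by
  ext j
  have h : Fin.last (m + 1) ≠ l.castSucc := (Fin.castSucc_lt_last l).ne'
  have h' : (0 : Fin (m + 2)) ≠ l.castSucc := fun h => hl (by simpa using h.symm)
  by_cases hj : j = 0
  · subst hj
    simp [lastFaceTuple, h, h', hl.symm]
  · simp [lastFaceTuple, Function.update_apply, hj, apply_ite (superTwist 𝓐 p)]

theorem lastFaceTuple_slot {m : ℕ} (p : ZMod 2) (a : Fin (m + 2) → A) (k : Fin (m + 2)) :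
    ∃ (l : Fin (m + 1)) (g : A →+ A), ∀ x,
      lastFaceTuple 𝓐 p (Function.update a k x)
        = Function.update (lastFaceTuple 𝓐 p a) l (g x) := by
  induction k using Fin.lastCases with
  | last =>
    exact ⟨0, (AddMonoidHom.mulRight (superTwist 𝓐 p (a 0))).comp (GradedRing.proj 𝓐 p),
      lastFaceTuple_update_last p a⟩
  | cast l =>
    by_cases hl : l = 0
    · subst hl
      exact ⟨0, (AddMonoidHom.mulLeft (GradedRing.proj 𝓐 p (a (Fin.last (m + 1))))).comp
        (superTwist 𝓐 p), lastFaceTuple_update_zero p a⟩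
    · exact ⟨l, superTwist 𝓐 p, lastFaceTuple_update_castSucc p a hl⟩

/-- The last face
`a₀ ⊗ … ⊗ a_{m+1} ↦ (-1)^{|a_{m+1}|(|a₀| + … + |a_m|)} a_{m+1} a₀ ⊗ a₁ ⊗ … ⊗ a_m` on tensor powers
over `ℤ` (see `lastFace_tprod_of_mem`). -/
def lastFace (𝓐 : ZMod 2 → AddSubgroup A) [GradedRing 𝓐] (m : ℕ) :
    (⨂[ℤ] _ : Fin (m + 2), A) →ₗ[ℤ] ⨂[ℤ] _ : Fin (m + 1), A :=
  ∑ p, PiTensorProduct.lift (slotMultilinear (lastFaceTuple 𝓐 p) (lastFaceTuple_slot p))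

theorem lastFace_tprod {m : ℕ} (a : Fin (m + 2) → A) :
    lastFace 𝓐 m (PiTensorProduct.tprod ℤ a)
      = ∑ p, PiTensorProduct.tprod ℤ (lastFaceTuple 𝓐 p a) := by
  rw [lastFace, LinearMap.sum_apply]
  exact Finset.sum_congr rfl fun p _ => PiTensorProduct.lift.tprod _

theorem superSign_sum (p : ZMod 2) {ι : Type*} (s : Finset ι) (f : ι → ZMod 2) :
    superSign p (∑ i ∈ s, f i) = ∏ i ∈ s, superSign p (f i) := by
  classical
  induction s using Finset.induction_on with
  | empty => simp [superSign]
  | insert i s hi ih => rw [Finset.sum_insert hi, Finset.prod_insert hi, superSign_add_right, ih]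

/-- The formula for the last face on homogeneous elements. -/
theorem lastFace_tprod_of_mem {m : ℕ} (a : Fin (m + 2) → A) (f : Fin (m + 2) → ZMod 2)
    (hf : ∀ j, a j ∈ 𝓐 (f j)) :
    lastFace 𝓐 m (PiTensorProduct.tprod ℤ a)
      = superSign (f (Fin.last (m + 1))) (∑ j : Fin (m + 1), f j.castSucc) •
        PiTensorProduct.tprod ℤ (fun j : Fin (m + 1) =>
          if j = 0 then a (Fin.last (m + 1)) * a 0 else a j.castSucc) := by
  rw [lastFace_tprod, Finset.sum_eq_single (f (Fin.last (m + 1))), superSign_sum,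
    ← MultilinearMap.map_smul_univ]
  · congr 1
    ext j
    simp only [lastFaceTuple]
    split_ifs with hj
    · subst hj
      rw [gradedRing_proj_of_mem _ (hf _), if_pos rfl, superTwist_of_mem _ (hf _), mul_smul_comm]
      rfl
    · exact superTwist_of_mem _ (hf _)
  · intro p _ hp
    refine MultilinearMap.map_coord_zero _ 0 ?_
    simp only [lastFaceTuple, if_true]
    rw [gradedRing_proj_of_mem _ (hf _), if_neg hp, zero_mul]
  · simp

namespace Superalgebra

variable (S : Superalgebra 𝓡 𝓐)

/-- The relations `… ⊗ a_l r ⊗ a_{l+1} ⊗ … = … ⊗ a_l ⊗ r a_{l+1} ⊗ …`, `r ∈ R`, in the tensor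
power of `A` over `ℤ` with `m + 1` factors. -/
def chainRel (m : ℕ) : Submodule ℤ (⨂[ℤ] _ : Fin (m + 1), A) :=
  Submodule.span ℤ {t | ∃ (l : Fin m) (a : Fin (m + 1) → A) (r : R),
    t = PiTensorProduct.tprod ℤ (Function.update a l.castSucc (a l.castSucc * S.toRingHom r))
      - PiTensorProduct.tprod ℤ (Function.update a l.succ (S.toRingHom r * a l.succ))}

/-- The group `C_m(A) = A ⊗_R A ⊗_R … ⊗_R A` (`m + 1` factors) of Hochschild chains. -/
def Chain (m : ℕ) : Type _ := (⨂[ℤ] _ : Fin (m + 1), A) ⧸ S.chainRel m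

instance (m : ℕ) : AddCommGroup (S.Chain m) :=
  inferInstanceAs (AddCommGroup ((⨂[ℤ] _ : Fin (m + 1), A) ⧸ S.chainRel m))

/-- The class of `a₀ ⊗ … ⊗ a_m` in `C_m(A)`. -/
def chainMk {m : ℕ} (a : Fin (m + 1) → A) : S.Chain m :=
  (S.chainRel m).mkQ (PiTensorProduct.tprod ℤ a)

/-- The action of `R` on tensors through the first factor. -/
def chainAction (m : ℕ) : R →+* Module.End ℤ (⨂[ℤ] _ : Fin (m + 1), A) where
  toFun r := PiTensorProduct.map (Function.update (fun _ => LinearMap.id) 0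
    (LinearMap.mulLeft ℤ (S.toRingHom r)))
  map_one' := by
    rw [map_one, LinearMap.mulLeft_one, Function.update_eq_self]
    exact PiTensorProduct.map_id
  map_zero' := by
    refine PiTensorProduct.ext (MultilinearMap.ext fun a => ?_)
    simp only [LinearMap.compMultilinearMap_apply, PiTensorProduct.map_tprod]
    exact MultilinearMap.map_coord_zero _ 0 (by simp)
  map_mul' r s := by
    rw [← PiTensorProduct.map_mul]
    congr 1
    ext j x
    by_cases hj : j = 0
    · subst hj; simp
    · simp [hj]
  map_add' r s := by
    rw [← PiTensorProduct.map_update_add]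
    congr 2
    ext x
    simp [add_mul]

theorem chainAction_tprod {m : ℕ} (r : R) (a : Fin (m + 1) → A) :
    S.chainAction m r (PiTensorProduct.tprod ℤ a)
      = PiTensorProduct.tprod ℤ (Function.update a 0 (S.toRingHom r * a 0)) := by
  refine (PiTensorProduct.map_tprod _ _).trans ?_
  congr 1
  ext j
  by_cases hj : j = 0
  · subst hj; simp
  · simp [hj]

theorem chainMk_rel {m : ℕ} (l : Fin m) (a : Fin (m + 1) → A) (r : R) :
    S.chainMk (Function.update a l.castSucc (a l.castSucc * S.toRingHom r))
      = S.chainMk (Function.update a l.succ (S.toRingHom r * a l.succ)) :=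
  (Submodule.Quotient.eq _).2 (Submodule.subset_span ⟨l, a, r, rfl⟩)

theorem chainAction_stable (m : ℕ) (r : R) :
    S.chainRel m ≤ (S.chainRel m).comap (S.chainAction m r) := by
  refine Submodule.span_le.2 ?_
  rintro _ ⟨l, a, s, rfl⟩
  refine Submodule.subset_span ⟨l, Function.update a 0 (S.toRingHom r * a 0), s, ?_⟩
  rw [map_sub, chainAction_tprod, chainAction_tprod]
  have h0 : l.succ ≠ 0 := Fin.succ_ne_zero l
  congr 2
  · by_cases h : l.castSucc = 0
    · rw [h]
      simp [mul_assoc]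
    · rw [Function.update_of_ne h, Function.update_of_ne (Ne.symm h), Function.update_comm h]
  · rw [Function.update_of_ne h0, Function.update_of_ne h0.symm, Function.update_comm h0]

instance (m : ℕ) : Module R (S.Chain m) :=
  Module.compHom ((⨂[ℤ] _ : Fin (m + 1), A) ⧸ S.chainRel m)
    (quotientAction (S.chainRel m) (S.chainAction m) (S.chainAction_stable m))

theorem smul_chainMk {m : ℕ} (r : R) (a : Fin (m + 1) → A) :
    r • S.chainMk a = S.chainMk (Function.update a 0 (S.toRingHom r * a 0)) :=
  congrArg (S.chainRel m).mkQ (S.chainAction_tprod r a)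

theorem faceTuple_rel_left {m : ℕ} (i : Fin (m + 1)) (l : Fin m) (h : l.castSucc < i)
    (a : Fin (m + 2) → A) (r : A) :
    faceTuple i (Function.update a l.castSucc.succ (r * a l.castSucc.succ))
      = Function.update (faceTuple i a) l.succ (r * faceTuple i a l.succ) := by
  rw [Fin.succ_castSucc]
  rcases eq_or_lt_of_le (show l.succ ≤ i from h) with rfl | h'
  · rw [faceTuple_update_castSucc_self, faceTuple_apply, if_neg (lt_irrefl _), if_pos rfl,
      mul_assoc]
  · rw [faceTuple_update_castSucc_lt h', faceTuple_apply i a l.succ, if_pos h']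

theorem chainMk_face_rel {m : ℕ} (i l : Fin (m + 1)) (a : Fin (m + 2) → A) (r : R) :
    S.chainMk (faceTuple i (Function.update a l.castSucc (a l.castSucc * S.toRingHom r)))
      = S.chainMk (faceTuple i (Function.update a l.succ (S.toRingHom r * a l.succ))) := by
  rcases lt_trichotomy l i with h | rfl | h
  · obtain ⟨l, rfl⟩ : ∃ k : Fin m, k.castSucc = l :=
      Fin.exists_castSucc_eq.2 (ne_of_lt (h.trans_le (Fin.le_last _)))
    have h1 : a l.castSucc.castSucc = faceTuple i a l.castSucc := by
      rw [faceTuple_apply, if_pos h]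
    rw [faceTuple_update_castSucc_lt h, faceTuple_rel_left i l h, h1, chainMk_rel]
  · rw [faceTuple_update_castSucc_self, faceTuple_update_succ_self, mul_assoc]
  · obtain ⟨l, rfl⟩ := Fin.exists_succ_eq.2 (show l ≠ 0 from fun h0 => by simp [h0] at h)
    have h1 : a l.succ.succ = faceTuple i a l.succ := by
      rw [faceTuple_apply, if_neg h.not_gt, if_neg h.ne']
    rw [faceTuple_update_succ_gt h, h1, ← chainMk_rel, ← Fin.succ_castSucc]
    rcases eq_or_lt_of_le (Fin.castSucc_lt_succ_iff.1 (show i.castSucc < l.castSucc.succ by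
      rw [Fin.succ_castSucc]; exact Fin.castSucc_lt_castSucc_iff.2 h)) with rfl | h'
    · rw [faceTuple_update_succ_self, faceTuple_apply, if_neg (lt_irrefl _), if_pos rfl, mul_assoc]
    · rw [faceTuple_update_succ_gt h', faceTuple_apply i a l.castSucc, if_neg h'.not_gt, if_neg h'.ne']

theorem mul_toRingHom {i : ZMod 2} {r : R} (hr : r ∈ 𝓡 i) (a : A) :
    a * S.toRingHom r = S.toRingHom r * superTwist 𝓐 i a := by
  induction a using DirectSum.Decomposition.inductionOn 𝓐 with
  | zero => simp
  | add a a' h h' => rw [add_mul, map_add, h, h', mul_add]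
  | @homogeneous j a =>
    rw [superTwist_of_mem i a.2, mul_smul_comm, S.supercentral hr a.2, smul_smul,
      superSign_mul_self, one_smul]

/-- Moving a scalar through the first `k` factors. -/
theorem chainMk_move {m : ℕ} {i : ZMod 2} {r : R} (hr : r ∈ 𝓡 i) (k : Fin (m + 1))
    (b : Fin (m + 1) → A) :
    S.chainMk (Function.update b k (b k * S.toRingHom r))
      = S.chainMk (fun j => if j = 0 then S.toRingHom r * superTwist 𝓐 i (b j)
          else if j ≤ k then superTwist 𝓐 i (b j) else b j) := by
  induction k using Fin.induction generalizing b with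
  | zero =>
    congr 1
    ext j
    by_cases hj : j = 0
    · subst hj; simp [S.mul_toRingHom hr]
    · simp [hj]
  | succ k ih =>
    have h := S.chainMk_rel k (Function.update b k.succ (superTwist 𝓐 i (b k.succ))) r
    rw [ih] at h
    rw [S.mul_toRingHom hr]
    simp only [Function.update_self, Function.update_idem] at h
    rw [← h]
    congr 1
    ext j
    rcases lt_trichotomy j k.succ with hj | rfl | hj
    · have h1 : j ≤ k.castSucc := Fin.le_castSucc_iff.2 hj
      simp [hj.ne, hj.le, h1]
    · have h1 : ¬ k.succ ≤ k.castSucc := not_le.2 Fin.castSucc_lt_succ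
      simp [h1]
    · have h1 : ¬ j ≤ k.castSucc := not_le.2 (Fin.castSucc_lt_succ.trans hj)
      have h2 : j ≠ 0 := ((Fin.zero_le _).trans_lt hj).ne'
      simp [hj.ne', hj.not_ge, h1, h2]

/-- To check that an additive map kills the relations, homogeneous scalars suffice. -/
theorem chainRel_le [GradedRing 𝓡] {m : ℕ} {N : Submodule ℤ (⨂[ℤ] _ : Fin (m + 1), A)}
    (h : ∀ (l : Fin m) (a : Fin (m + 1) → A) (i : ZMod 2) (r : R), r ∈ 𝓡 i →
      PiTensorProduct.tprod ℤ (Function.update a l.castSucc (a l.castSucc * S.toRingHom r))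
      - PiTensorProduct.tprod ℤ (Function.update a l.succ (S.toRingHom r * a l.succ)) ∈ N) :
    S.chainRel m ≤ N := by
  refine Submodule.span_le.2 ?_
  rintro _ ⟨l, a, r, rfl⟩
  rw [SetLike.mem_coe]
  induction r using DirectSum.Decomposition.inductionOn 𝓡 with
  | zero =>
    rw [map_zero, mul_zero, zero_mul, MultilinearMap.map_update_zero,
      MultilinearMap.map_update_zero, sub_zero]
    exact zero_mem _
  | add r s hr hs =>
    rw [map_add, mul_add, add_mul, MultilinearMap.map_update_add, MultilinearMap.map_update_add,
      add_sub_add_comm]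
    exact add_mem hr hs
  | @homogeneous i r => exact h l a i r r.2

theorem superTwist_toRingHom {i : ZMod 2} {r : R} (hr : r ∈ 𝓡 i) (p : ZMod 2) :
    superTwist 𝓐 p (S.toRingHom r) = superSign p i • S.toRingHom r :=
  superTwist_of_mem p (S.map_mem hr)

theorem superTwist_superTwist (p q : ZMod 2) (a : A) :
    superTwist 𝓐 p (superTwist 𝓐 q a) = superTwist 𝓐 (p + q) a := by
  induction a using DirectSum.Decomposition.inductionOn 𝓐 with
  | zero => simp
  | add a a' h h' => rw [map_add, map_add, h, h', map_add]
  | homogeneous a =>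
    rw [superTwist_of_mem q a.2, map_zsmul, superTwist_of_mem p a.2, superTwist_of_mem _ a.2,
      smul_smul, superSign_add_left, mul_comm]

theorem proj_toRingHom_mul {i : ZMod 2} {r : R} (hr : r ∈ 𝓡 i) (p : ZMod 2) (a : A) :
    GradedRing.proj 𝓐 (p + i) (S.toRingHom r * a) = S.toRingHom r * GradedRing.proj 𝓐 p a := by
  induction a using DirectSum.Decomposition.inductionOn 𝓐 with
  | zero => simp
  | add a a' h h' => rw [mul_add, map_add, h, h', map_add, mul_add]
  | @homogeneous j a =>
    rw [gradedRing_proj_of_mem _ a.2,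
      gradedRing_proj_of_mem _ (SetLike.mul_mem_graded (S.map_mem hr) a.2), add_comm p i]
    simp only [add_right_inj]
    split_ifs <;> simp

theorem chainMk_update_smul {m : ℕ} (a : Fin (m + 1) → A) (k : Fin (m + 1)) (c : ℤ) (x : A) :
    S.chainMk (Function.update a k (c • x)) = c • S.chainMk (Function.update a k x) := by
  simp only [chainMk]
  rw [MultilinearMap.map_update_smul]
  rfl

theorem chainMk_update_smul_self {m : ℕ} (a : Fin (m + 1) → A) (k : Fin (m + 1)) (c : ℤ) :
    S.chainMk (Function.update a k (c • a k)) = c • S.chainMk a := by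
  rw [chainMk_update_smul, Function.update_eq_self]

theorem lastFaceTuple_rel_left {m : ℕ} (p i : ZMod 2) (l : Fin (m + 1)) (a : Fin (m + 2) → A)
    {r : R} (hr : r ∈ 𝓡 i) :
    S.chainMk (lastFaceTuple 𝓐 p
        (Function.update a l.castSucc (a l.castSucc * S.toRingHom r)))
      = superSign p i • S.chainMk (Function.update (lastFaceTuple 𝓐 p a) l
          (lastFaceTuple 𝓐 p a l * S.toRingHom r)) := by
  by_cases h : l = 0
  · subst h
    have h1 := lastFaceTuple_update_zero (𝓐 := 𝓐) p a (a 0 * S.toRingHom r)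
    rw [superTwist_mul, S.superTwist_toRingHom hr, mul_smul_comm, mul_smul_comm, ← mul_assoc] at h1
    rw [Fin.castSucc_zero, h1, chainMk_update_smul]
    rfl
  · rw [lastFaceTuple_update_castSucc p a h, superTwist_mul, S.superTwist_toRingHom hr,
      mul_smul_comm, chainMk_update_smul, lastFaceTuple, if_neg h]

theorem lastFaceTuple_rel_right {m : ℕ} (p i : ZMod 2) (l : Fin m) (a : Fin (m + 2) → A)
    {r : R} (hr : r ∈ 𝓡 i) :
    S.chainMk (lastFaceTuple 𝓐 p
        (Function.update a l.succ.castSucc (S.toRingHom r * a l.succ.castSucc)))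
      = superSign p i • S.chainMk (Function.update (lastFaceTuple 𝓐 p a) l.succ
          (S.toRingHom r * lastFaceTuple 𝓐 p a l.succ)) := by
  have h : l.succ ≠ 0 := Fin.succ_ne_zero l
  rw [lastFaceTuple_update_castSucc p a h, superTwist_mul, S.superTwist_toRingHom hr,
    smul_mul_assoc, chainMk_update_smul, lastFaceTuple, if_neg h]

theorem sum_lastFaceTuple_rel {m : ℕ} (i : ZMod 2) (l : Fin (m + 1)) (a : Fin (m + 2) → A)
    {r : R} (hr : r ∈ 𝓡 i) :
    ∑ p, S.chainMk (lastFaceTuple 𝓐 p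
        (Function.update a l.castSucc (a l.castSucc * S.toRingHom r)))
      = ∑ p, S.chainMk (lastFaceTuple 𝓐 p
        (Function.update a l.succ (S.toRingHom r * a l.succ))) := by
  induction l using Fin.lastCases with
  | cast l =>
    refine Finset.sum_congr rfl fun p _ => ?_
    rw [S.lastFaceTuple_rel_left p i l.castSucc a hr, Fin.succ_castSucc,
      S.lastFaceTuple_rel_right p i l a hr, chainMk_rel]
  | last =>
    rw [Fin.succ_last, ← Equiv.sum_comp (Equiv.addRight i) (fun p => S.chainMk (lastFaceTuple 𝓐 p
      (Function.update a (Fin.last (m + 1)) (S.toRingHom r * a (Fin.last (m + 1))))))]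
    refine Finset.sum_congr rfl fun p _ => ?_
    rw [S.lastFaceTuple_rel_left p i _ a hr, S.chainMk_move hr, Equiv.coe_addRight,
      lastFaceTuple_update_last, S.proj_toRingHom_mul hr]
    rw [← S.chainMk_update_smul_self _ 0]
    congr 1
    ext j
    by_cases hj : j = 0
    · subst hj
      have h1 : superTwist 𝓐 i (GradedRing.proj 𝓐 p (a (Fin.last (m + 1))))
          = superSign i p • GradedRing.proj 𝓐 p (a (Fin.last (m + 1))) :=
        superTwist_of_mem i (SetLike.coe_mem _)
      simp only [lastFaceTuple, if_true, Function.update_self]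
      rw [superTwist_mul, h1, superTwist_superTwist, smul_mul_assoc, mul_smul_comm, smul_smul,
        superSign_comm p i, superSign_mul_self, one_smul, add_comm i p, mul_assoc]
    · simp [lastFaceTuple, hj, Fin.le_last, superTwist_superTwist, add_comm i p]

theorem lastFaceTuple_smul {m : ℕ} (p i : ZMod 2) (a : Fin (m + 2) → A)
    {r : R} (hr : r ∈ 𝓡 i) :
    lastFaceTuple 𝓐 p (Function.update a 0 (S.toRingHom r * a 0))
      = Function.update (lastFaceTuple 𝓐 p a) 0 (S.toRingHom r * lastFaceTuple 𝓐 p a 0) := by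
  have h : GradedRing.proj 𝓐 p (a (Fin.last (m + 1))) * S.toRingHom r
      = superSign p i • (S.toRingHom r * GradedRing.proj 𝓐 p (a (Fin.last (m + 1)))) := by
    have h1 : superTwist 𝓐 i (GradedRing.proj 𝓐 p (a (Fin.last (m + 1))))
        = superSign i p • GradedRing.proj 𝓐 p (a (Fin.last (m + 1))) :=
      superTwist_of_mem i (SetLike.coe_mem _)
    rw [S.mul_toRingHom hr, h1, mul_smul_comm, superSign_comm]
  rw [lastFaceTuple_update_zero, superTwist_mul, S.superTwist_toRingHom hr, smul_mul_assoc,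
    mul_smul_comm, ← mul_assoc, h, smul_mul_assoc, smul_smul, superSign_mul_self, one_smul,
    mul_assoc]
  rfl

theorem faceTuple_smul {m : ℕ} (i : Fin (m + 1)) (a : Fin (m + 2) → A) (x : A) :
    faceTuple i (Function.update a 0 (x * a 0))
      = Function.update (faceTuple i a) 0 (x * faceTuple i a 0) := by
  rcases eq_or_ne i 0 with rfl | h
  · have := faceTuple_update_castSucc_self 0 a (x * a 0)
    rw [Fin.castSucc_zero] at this
    rw [this, faceTuple_apply, if_neg (lt_irrefl _), if_pos rfl, mul_assoc]
    rfl
  · have h0 : 0 < i := Fin.pos_iff_ne_zero.2 h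
    have := faceTuple_update_castSucc_lt h0 a (x * a 0)
    rw [Fin.castSucc_zero] at this
    rw [this, faceTuple_apply i a 0, if_pos h0]
    rfl

/-- The Hochschild differential `∑_{i ≤ m+1} (-1)^i δ_i` on tensor powers over `ℤ`. -/
def dTensor (𝓐 : ZMod 2 → AddSubgroup A) [GradedRing 𝓐] (m : ℕ) :
    (⨂[ℤ] _ : Fin (m + 2), A) →ₗ[ℤ] ⨂[ℤ] _ : Fin (m + 1), A :=
  ∑ i : Fin (m + 1), (-1 : ℤ) ^ (i : ℕ) • face i + (-1 : ℤ) ^ (m + 1) • lastFace 𝓐 m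

theorem mkQ_dTensor {m : ℕ} (a : Fin (m + 2) → A) :
    (S.chainRel m).mkQ (dTensor 𝓐 m (PiTensorProduct.tprod ℤ a))
      = ∑ i : Fin (m + 1), (-1 : ℤ) ^ (i : ℕ) • S.chainMk (faceTuple i a)
        + (-1 : ℤ) ^ (m + 1) • ∑ p, S.chainMk (lastFaceTuple 𝓐 p a) := by
  simp only [dTensor, LinearMap.add_apply, LinearMap.sum_apply, LinearMap.smul_apply, face_tprod,
    lastFace_tprod, map_add, map_sum, map_smul]
  rfl

theorem dTensor_stable [GradedRing 𝓡] (m : ℕ) :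
    S.chainRel (m + 1) ≤ (S.chainRel m).comap (dTensor 𝓐 m) := by
  refine S.chainRel_le fun l a i r hr => ?_
  rw [Submodule.mem_comap, map_sub, ← Submodule.Quotient.eq]
  refine (S.mkQ_dTensor _).trans (Eq.trans ?_ (S.mkQ_dTensor _).symm)
  simp only [S.chainMk_face_rel, S.sum_lastFaceTuple_rel i l a hr]
  rfl

@[elab_as_elim]
theorem chain_induction {m : ℕ} {motive : S.Chain m → Prop} (x : S.Chain m)
    (mk : ∀ (c : ℤ) a, motive (c • S.chainMk a))
    (add : ∀ x y, motive x → motive y → motive (x + y)) : motive x := by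
  obtain ⟨t, rfl⟩ := Submodule.mkQ_surjective (S.chainRel m) x
  induction t using PiTensorProduct.induction_on with
  | smul_tprod c a => exact mk c a
  | add x y hx hy => exact add _ _ hx hy

/-- The Hochschild differential as an additive map. -/
def dHom [GradedRing 𝓡] (m : ℕ) : S.Chain (m + 1) →+ S.Chain m :=
  ((S.chainRel (m + 1)).mapQ (S.chainRel m) (dTensor 𝓐 m) (S.dTensor_stable m)).toAddMonoidHom

theorem dHom_chainMk [GradedRing 𝓡] {m : ℕ} (a : Fin (m + 2) → A) :
    S.dHom m (S.chainMk a) = ∑ i : Fin (m + 1), (-1 : ℤ) ^ (i : ℕ) • S.chainMk (faceTuple i a)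
        + (-1 : ℤ) ^ (m + 1) • ∑ p, S.chainMk (lastFaceTuple 𝓐 p a) :=
  S.mkQ_dTensor a

theorem dHom_smul [GradedRing 𝓡] {m : ℕ} (r : R) (x : S.Chain (m + 1)) :
    S.dHom m (r • x) = r • S.dHom m x := by
  induction r using DirectSum.Decomposition.inductionOn 𝓡 with
  | zero => simp
  | add r s hr hs => rw [add_smul, map_add, hr, hs, add_smul]
  | @homogeneous i r =>
    induction x using chain_induction with
    | mk c a =>
      rw [smul_comm (r : R) c, map_zsmul, map_zsmul, smul_comm (r : R) c]
      congr 1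
      rw [smul_chainMk, dHom_chainMk, dHom_chainMk, smul_add, Finset.smul_sum, smul_comm (r : R) ((-1 : ℤ) ^ (m + 1)),
        Finset.smul_sum]
      simp only [Finset.smul_sum, smul_comm (r : R) (_ : ℤ), smul_chainMk, faceTuple_smul,
        S.lastFaceTuple_smul _ i a r.2]
    | add x y hx hy => rw [smul_add, map_add, hx, hy, map_add, smul_add]

/-- The Hochschild differential `d = ∑_{i ≤ m+1} (-1)^i δ_i : C_{m+1}(A) → C_m(A)`. -/
def d [GradedRing 𝓡] (m : ℕ) : S.Chain (m + 1) →ₗ[R] S.Chain m where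
  __ := S.dHom m
  map_smul' := S.dHom_smul

/-- The formula for the Hochschild differential on homogeneous elements. -/
theorem d_chainMk_of_mem [GradedRing 𝓡] {m : ℕ} (a : Fin (m + 2) → A) (f : Fin (m + 2) → ZMod 2)
    (hf : ∀ j, a j ∈ 𝓐 (f j)) :
    S.d m (S.chainMk a)
      = ∑ i : Fin (m + 1), (-1 : ℤ) ^ (i : ℕ) • S.chainMk (fun j : Fin (m + 1) =>
          if j < i then a j.castSucc else if j = i then a j.castSucc * a j.succ else a j.succ)
        + (-1 : ℤ) ^ (m + 1) •
          superSign (f (Fin.last (m + 1))) (∑ j : Fin (m + 1), f j.castSucc) •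
          S.chainMk (fun j : Fin (m + 1) =>
            if j = 0 then a (Fin.last (m + 1)) * a 0 else a j.castSucc) := by
  have h : ∑ p, S.chainMk (lastFaceTuple 𝓐 p a)
      = (S.chainRel m).mkQ (lastFace 𝓐 m (PiTensorProduct.tprod ℤ a)) := by
    rw [lastFace_tprod, map_sum]
    rfl
  have h' : ∀ i : Fin (m + 1), (fun j : Fin (m + 1) =>
      if j < i then a j.castSucc else if j = i then a j.castSucc * a j.succ else a j.succ)
      = faceTuple i a := fun i => funext fun j => (faceTuple_apply i a j).symm
  simp only [h']
  refine (S.dHom_chainMk a).trans ?_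
  rw [h, lastFace_tprod_of_mem a f hf]
  rfl

/-- The part of `C_m(A)` of parity `k`: generated by the `a₀ ⊗ … ⊗ a_m` with all `a_j`
homogeneous and `|a₀| + … + |a_m| = k`. -/
def chainGrading (m : ℕ) (k : ZMod 2) : AddSubgroup (S.Chain m) :=
  AddSubgroup.closure {t | ∃ (f : Fin (m + 1) → ZMod 2) (a : Fin (m + 1) → A),
    (∀ j, a j ∈ 𝓐 (f j)) ∧ ∑ j, f j = k ∧ t = S.chainMk a}

/-- Hochschild cycles; every chain of degree `0` is a cycle. -/
def cycles [GradedRing 𝓡] : (n : ℕ) → Submodule R (S.Chain n)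
  | 0 => ⊤
  | n + 1 => LinearMap.ker (S.d n)

/-- Hochschild boundaries. -/
def boundaries [GradedRing 𝓡] (n : ℕ) : Submodule R (S.Chain n) :=
  LinearMap.range (S.d n)

/-- The Hochschild homology `H_n(A)` of the `R`-superalgebra `A`: cycles modulo boundaries. -/
abbrev Homology [GradedRing 𝓡] (n : ℕ) : Type _ :=
  S.cycles n ⧸ (S.boundaries n).submoduleOf (S.cycles n)

/-- The part of `H_n(A)` of parity `k`: the classes of the cycles of parity `k`. -/
def homologyGrading [GradedRing 𝓡] (n : ℕ) (k : ZMod 2) : AddSubgroup (S.Homology n) :=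
  ((S.chainGrading n k).comap (S.cycles n).subtype.toAddMonoidHom).map
    ((S.boundaries n).submoduleOf (S.cycles n)).mkQ.toAddMonoidHom

end Superalgebra

end Hochschild

end

noncomputable section

/-! ### Hochschild chains indexed by sequences -/

section Words

variable {R : Type*} [Ring R] {𝓡 : ZMod 2 → AddSubgroup R}
  {A : Type*} [Ring A] {𝓐 : ZMod 2 → AddSubgroup A} [GradedRing 𝓐]
  {A' : Type*} [Ring A'] {𝓐' : ZMod 2 → AddSubgroup A'} [GradedRing 𝓐']

/-! The superalgebras `A` and `B` are opposite corners of one superalgebra `L`, the matrices with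
diagonal entries in `A`, `B` and off-diagonal entries in `P`, `Q`. Both corners are full, and the
inclusion of a full corner is an isomorphism on Hochschild homology. Composing one such isomorphism
with the inverse of the other gives the result.

To multiply in `L` one needs pairings `P ⊗_B Q → A` and `Q ⊗_A P → B` that are associative with each
other, and two arbitrary isomorphisms need not be. The first pairing is kept and the second is
rebuilt from it, using that an `A`-linear endomorphism of `P` is right multiplication by an element
of `B` (`pairing_map_eq`). This is `SuperMoritaEquivalent.exists_moritaContext`.

For a corner `e L e`, fullness is used in the form `1 = ∑ y_t x_t` with `e x_t = x_t`, `y_t e =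
y_t`, and `x_t`, `y_t` homogeneous of equal parity. Think of a chain as `n + 1` entries on a circle,
with gap `j` following `a_j`. The junction operator at gap `j` replaces `a_j ⊗ a_{j+1}` by `∑ a_j
y_t ⊗ x_t a_{j+1}`. The face `i` closes gap `i`: it commutes with the junctions at the other gaps,
up to renumbering (`faceHom_junction_succ`, `faceHom_junction_of_lt`), and it absorbs a junction at
its own gap because `∑ y_t x_t = 1` (`sum_faceHom_junction`). Hence the composite of the junctions
at all gaps is a chain map. Filling the gaps one at a time, with a degeneracy opening the next one,
is a simplicial homotopy from it to the identity (`sub_iterJunction_mem_boundaries`).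

After all gaps are filled every entry has the form `x a y`, so it lies in `e L e`. The full junction
operator of `L` therefore factors through the chains of the corner, which gives a trace map back
(`traceChain`). It inverts the inclusion on homology, since the homotopy is available both in `L`
and, after compressing the pairs, in the corner (`sum_retr`).

The signs rest on one computation: `(q + p)(s + p) = qs + p(1 + s + q)` modulo 2, because `p² = p`.
This dictates the sign of the cyclic junction. -/

theorem sum_gradedRing_proj (a : A) : ∑ i, GradedRing.proj 𝓐 i a = a := by
  classical
  conv_rhs => rw [← DirectSum.sum_support_decompose 𝓐 a]
  refine (Finset.sum_subset (Finset.subset_univ _) fun k _ hk => ?_).symm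
  rw [DFinsupp.notMem_support_iff] at hk
  exact congrArg Subtype.val hk

namespace Superalgebra

variable (S : Superalgebra 𝓡 𝓐) (S' : Superalgebra 𝓡 𝓐')

/-- The chain `a₀ ⊗ … ⊗ a_n` attached to a sequence `a`. -/
def word (n : ℕ) (a : ℕ → A) : S.Chain n := S.chainMk fun j : Fin (n + 1) => a j

variable {S S'}

/-- Only the first `n + 1` entries of a sequence matter. Working with sequences on `ℕ` turns shifts
of indices into plain arithmetic, free of coercions between the types `Fin`. -/
theorem word_congr {n : ℕ} {a b : ℕ → A} (h : ∀ j ≤ n, a j = b j) : S.word n a = S.word n b :=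
  congrArg S.chainMk (funext fun j => h j (Nat.lt_succ_iff.1 j.2))

theorem word_fin {n : ℕ} (a : Fin (n + 1) → A) :
    S.chainMk a = S.word n fun j => if h : j < n + 1 then a ⟨j, h⟩ else 0 :=
  congrArg S.chainMk (funext fun j => by simp only [j.2, dite_true])

theorem word_sum {n : ℕ} {ι : Type*} (s : Finset ι) {l : ℕ} (hl : l ≤ n) (a : ℕ → A)
    (c : ι → A) :
    S.word n (Function.update a l (∑ i ∈ s, c i))
      = ∑ i ∈ s, S.word n (Function.update a l (c i)) := by
  have h : ∀ x, S.word n (Function.update a l x)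
      = S.chainMk (Function.update (fun j : Fin (n + 1) => a j) ⟨l, Nat.lt_succ_of_le hl⟩ x) := by
    intro x
    refine congrArg S.chainMk (funext fun j => ?_)
    simp only [Function.update_apply, Fin.ext_iff]
  simp only [h]
  refine (congrArg (S.chainRel n).mkQ (MultilinearMap.map_update_sum _ _ _ _ _)).trans ?_
  exact map_sum (S.chainRel n).mkQ _ _

theorem word_rel {n l : ℕ} (hl : l < n) (a : ℕ → A) (r : R) :
    S.word n (Function.update a l (a l * S.toRingHom r))
      = S.word n (Function.update a (l + 1) (S.toRingHom r * a (l + 1))) := by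
  have h := S.chainMk_rel ⟨l, hl⟩ (fun j : Fin (n + 1) => a j) r
  refine Eq.trans (congrArg S.chainMk (funext fun j => ?_))
    (h.trans (congrArg S.chainMk (funext fun j => ?_)))
  · simp [Function.update_apply, Fin.ext_iff]
  · simp [Function.update_apply, Fin.ext_iff]

/-- Additive maps out of the Hochschild chains are determined by their values on tensors of
homogeneous elements. -/
theorem chain_hom_ext {n : ℕ} {G : Type*} [AddCommGroup G] {f g : S.Chain n →+ G}
    (h : ∀ (a : ℕ → A) (p : ℕ → ZMod 2), (∀ j, a j ∈ 𝓐 (p j)) →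
      f (S.word n a) = g (S.word n a)) : f = g := by
  classical
  ext x
  induction x using chain_induction with
  | add x y hx hy => rw [map_add, map_add, hx, hy]
  | mk c a =>
    rw [map_zsmul, map_zsmul]
    congr 1
    have ha : a = fun j => ∑ i : ZMod 2, GradedRing.proj 𝓐 i (a j) := by
      funext j
      exact (sum_gradedRing_proj (a j)).symm
    -- Expanding every entry into its homogeneous parts gives one summand for each choice of
    -- parities.
    have hc : S.chainMk a = ∑ p : Fin (n + 1) → ZMod 2,
        S.chainMk fun j => GradedRing.proj 𝓐 (p j) (a j) := by
      conv_lhs => rw [ha]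
      exact (congrArg (S.chainRel n).mkQ (MultilinearMap.map_sum _ _)).trans
        (map_sum (S.chainRel n).mkQ _ _)
    rw [hc, map_sum, map_sum]
    refine Finset.sum_congr rfl fun p _ => ?_
    -- Padding by `0` is harmless, since `0` is homogeneous of every parity.
    have := h (fun j => if h : j < n + 1 then GradedRing.proj 𝓐 (p ⟨j, h⟩) (a ⟨j, h⟩) else 0)
      (fun j => if h : j < n + 1 then p ⟨j, h⟩ else 0) (fun j => by
        split_ifs
        · exact SetLike.coe_mem _
        · exact zero_mem _)
    rwa [← word_fin fun j => GradedRing.proj 𝓐 (p j) (a j)] at this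

/-- The slot maps may anticommute with scalars. What matters is that the two sides of a relation
acquire the same factor `c`, which can depend on the position and on the scalar. Restricting to
homogeneous scalars allows Koszul signs here. -/
theorem slotMap_stable [GradedRing 𝓡] {n : ℕ} (g : ℕ → A →+ A')
    (hg : ∀ l < n, ∀ ⦃i : ZMod 2⦄ ⦃r : R⦄, r ∈ 𝓡 i → ∃ c : ℤ,
      (∀ a, g l (a * S.toRingHom r) = c • (g l a * S'.toRingHom r)) ∧
      ∀ a, g (l + 1) (S.toRingHom r * a) = c • (S'.toRingHom r * g (l + 1) a)) :
    S.chainRel n ≤ (S'.chainRel n).comap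
      (PiTensorProduct.map fun k : Fin (n + 1) => (g k).toIntLinearMap) := by
  refine S.chainRel_le fun l a i r hr => ?_
  obtain ⟨c, h₁, h₂⟩ := hg l l.2 hr
  have e : ∀ (k : Fin (n + 1)) (x : A),
      (PiTensorProduct.map fun k : Fin (n + 1) => (g k).toIntLinearMap)
        (PiTensorProduct.tprod ℤ (Function.update a k x))
      = PiTensorProduct.tprod ℤ (Function.update (fun j : Fin (n + 1) => g j (a j)) k (g k x)) := by
    intro k x
    rw [PiTensorProduct.map_tprod]
    congr 1
    funext j
    rcases eq_or_ne j k with rfl | hj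
    · simp
    · simp [hj]
  rw [Submodule.mem_comap, map_sub, ← Submodule.Quotient.eq, e, e]
  simp only [Fin.val_castSucc, Fin.val_succ, h₁, h₂]
  refine (S'.chainMk_update_smul _ _ _ _).trans (Eq.trans ?_ (S'.chainMk_update_smul _ _ _ _).symm)
  exact congrArg _ (S'.chainMk_rel l (fun j : Fin (n + 1) => g j (a j)) r)

/-- The map `a₀ ⊗ … ⊗ a_n ↦ g₀ a₀ ⊗ … ⊗ g_n a_n`. -/
def slotMap [GradedRing 𝓡] {n : ℕ} (g : ℕ → A →+ A')
    (hg : ∀ l < n, ∀ ⦃i : ZMod 2⦄ ⦃r : R⦄, r ∈ 𝓡 i → ∃ c : ℤ,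
      (∀ a, g l (a * S.toRingHom r) = c • (g l a * S'.toRingHom r)) ∧
      ∀ a, g (l + 1) (S.toRingHom r * a) = c • (S'.toRingHom r * g (l + 1) a)) :
    S.Chain n →+ S'.Chain n :=
  ((S.chainRel n).mapQ (S'.chainRel n) (PiTensorProduct.map fun k : Fin (n + 1) =>
    (g k).toIntLinearMap) (slotMap_stable g hg)).toAddMonoidHom

theorem slotMap_word [GradedRing 𝓡] {n : ℕ} (g : ℕ → A →+ A')
    (hg : ∀ l < n, ∀ ⦃i : ZMod 2⦄ ⦃r : R⦄, r ∈ 𝓡 i → ∃ c : ℤ,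
      (∀ a, g l (a * S.toRingHom r) = c • (g l a * S'.toRingHom r)) ∧
      ∀ a, g (l + 1) (S.toRingHom r * a) = c • (S'.toRingHom r * g (l + 1) a)) (a : ℕ → A) :
    slotMap g hg (S.word n a) = S'.word n fun j => g j (a j) :=
  congrArg (S'.chainRel n).mkQ (PiTensorProduct.map_tprod _ _)

variable (S)

/-! ### Faces and degeneracies -/

/-- The inner face `a₀ ⊗ … ⊗ a_{n+1} ↦ a₀ ⊗ … ⊗ a_i a_{i+1} ⊗ … ⊗ a_{n+1}`. -/
def innerFace (n : ℕ) (i : Fin (n + 1)) : S.Chain (n + 1) →+ S.Chain n :=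
  ((S.chainRel (n + 1)).mapQ (S.chainRel n) (face i) (by
    refine Submodule.span_le.2 ?_
    rintro _ ⟨l, a, r, rfl⟩
    rw [SetLike.mem_coe, Submodule.mem_comap, map_sub, ← Submodule.Quotient.eq, face_tprod,
      face_tprod]
    exact S.chainMk_face_rel i l a r)).toAddMonoidHom

/-- The last, cyclic, face. -/
def cyclicFace [GradedRing 𝓡] (n : ℕ) : S.Chain (n + 1) →+ S.Chain n :=
  ((S.chainRel (n + 1)).mapQ (S.chainRel n) (lastFace 𝓐 n) (by
    refine S.chainRel_le fun l a i r hr => ?_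
    rw [Submodule.mem_comap, map_sub, ← Submodule.Quotient.eq, lastFace_tprod, lastFace_tprod]
    refine (map_sum (S.chainRel n).mkQ _ _).trans
      (Eq.trans ?_ (map_sum (S.chainRel n).mkQ _ _).symm)
    exact S.sum_lastFaceTuple_rel i l a hr)).toAddMonoidHom

/-- The faces of the Hochschild complex; the one of index `n + 1` is the cyclic one. -/
def faceHom [GradedRing 𝓡] (n i : ℕ) : S.Chain (n + 1) →+ S.Chain n :=
  if h : i < n + 1 then S.innerFace n ⟨i, h⟩ else S.cyclicFace n

variable {S}

theorem faceHom_word [GradedRing 𝓡] {n i : ℕ} (hi : i ≤ n) (a : ℕ → A) :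
    S.faceHom n i (S.word (n + 1) a) = S.word n fun j =>
      if j < i then a j else if j = i then a j * a (j + 1) else a (j + 1) := by
  rw [faceHom, dif_pos (Nat.lt_succ_of_le hi)]
  refine (congrArg (S.chainRel n).mkQ (face_tprod _ _)).trans
    (congrArg S.chainMk (funext fun j => ?_))
  rw [faceTuple_apply]
  simp [Fin.lt_def, Fin.ext_iff]

theorem faceHom_last_word [GradedRing 𝓡] {n : ℕ} (a : ℕ → A) (p : ℕ → ZMod 2)
    (ha : ∀ j, a j ∈ 𝓐 (p j)) :
    S.faceHom n (n + 1) (S.word (n + 1) a)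
      = superSign (p (n + 1)) (∑ j ∈ Finset.range (n + 1), p j) •
        S.word n fun j => if j = 0 then a (n + 1) * a 0 else a j := by
  rw [faceHom, dif_neg (lt_irrefl _), Finset.sum_range]
  refine (congrArg (S.chainRel n).mkQ
    (lastFace_tprod_of_mem (fun j : Fin (n + 2) => a j) (fun j => p j) fun j => ha j)).trans ?_
  rw [map_smul]
  refine congrArg _ (congrArg S.chainMk (funext fun j => ?_))
  simp only [Fin.ext_iff, Fin.val_zero, Fin.val_last, Fin.val_castSucc]

/-- Treating the cyclic face as just another face makes the simplicial arguments below uniform in `i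
≤ n + 1`. -/
theorem d_eq_sum_faceHom [GradedRing 𝓡] (n : ℕ) (x : S.Chain (n + 1)) :
    S.d n x = ∑ i ∈ Finset.range (n + 2), (-1 : ℤ) ^ i • S.faceHom n i x := by
  obtain ⟨t, rfl⟩ := Submodule.mkQ_surjective (S.chainRel (n + 1)) x
  rw [Finset.sum_range_succ, Finset.sum_range]
  have h : ∀ i : Fin (n + 1), S.faceHom n i = S.innerFace n i := fun i => dif_pos i.2
  have h' : S.faceHom n (n + 1) = S.cyclicFace n := dif_neg (lt_irrefl _)
  simp only [h, h']
  change (S.chainRel n).mkQ (dTensor 𝓐 n t) = _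
  simp only [dTensor, LinearMap.add_apply, LinearMap.sum_apply, LinearMap.smul_apply, map_add,
    map_sum, map_smul]
  rfl

/-- `(a₀, …, a_n) ↦ (a₀, …, a_k, 1, a_{k+1}, …, a_n)`. -/
def insertOne (n k : ℕ) (a : Fin (n + 1) → A) (j : Fin (n + 2)) : A :=
  let b : ℕ → A := fun j => if h : j < n + 1 then a ⟨j, h⟩ else 0
  if (j : ℕ) ≤ k then b j else if (j : ℕ) = k + 1 then 1 else b (j - 1)

theorem insertOne_update_le {n k : ℕ} (a : Fin (n + 1) → A) (l : Fin (n + 1)) (h : (l : ℕ) ≤ k)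
    (x : A) : insertOne n k (Function.update a l x)
      = Function.update (insertOne n k a) l.castSucc x := by
  ext j
  simp only [insertOne, Function.update_apply, Fin.ext_iff, Fin.val_castSucc]
  grind

theorem insertOne_update_gt {n k : ℕ} (a : Fin (n + 1) → A) (l : Fin (n + 1)) (h : k < (l : ℕ))
    (x : A) : insertOne n k (Function.update a l x)
      = Function.update (insertOne n k a) l.succ x := by
  ext j
  simp only [insertOne, Function.update_apply, Fin.ext_iff, Fin.val_succ]
  grind

theorem insertOne_slot {n k : ℕ} (a : Fin (n + 1) → A) (l : Fin (n + 1)) :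
    ∃ (l' : Fin (n + 2)) (g : A →+ A), ∀ x,
      insertOne n k (Function.update a l x) = Function.update (insertOne n k a) l' (g x) := by
  rcases le_or_gt (l : ℕ) k with h | h
  · exact ⟨l.castSucc, AddMonoidHom.id A, insertOne_update_le a l h⟩
  · exact ⟨l.succ, AddMonoidHom.id A, insertOne_update_gt a l h⟩

theorem chainMk_insertOne_rel {n k : ℕ} (l : Fin n) (a : Fin (n + 1) → A) (r : R) :
    S.chainMk (insertOne n k (Function.update a l.castSucc (a l.castSucc * S.toRingHom r)))
      = S.chainMk (insertOne n k (Function.update a l.succ (S.toRingHom r * a l.succ))) := by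
  set b : ℕ → A := fun j => if h : j < n + 1 then a ⟨j, h⟩ else 0 with hb
  set c : ℕ → A := fun j => if j ≤ k then b j else if j = k + 1 then 1 else b (j - 1) with hc
  have e : ∀ (l : Fin (n + 1)) (x : A), S.chainMk (insertOne n k (Function.update a l x))
      = S.word (n + 1) (Function.update c (if (l : ℕ) ≤ k then l else l + 1) x) := by
    intro l x
    refine congrArg S.chainMk (funext fun j => ?_)
    simp only [insertOne, Function.update_apply, Fin.ext_iff, hc, hb]
    grind
  have hl := l.2
  have b1 : a l.castSucc = b l := by simp [hb, hl.le]; rfl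
  have b2 : a l.succ = b (l + 1) := by simp [hb, hl]; rfl
  rw [e, e, b1, b2, Fin.val_castSucc, Fin.val_succ]
  rcases lt_trichotomy (l : ℕ) k with h | h | h
  · rw [if_pos h.le, if_pos (Nat.succ_le_of_lt h)]
    have := S.word_rel (Nat.lt_succ_of_lt hl) c r
    simpa [hc, h.le, Nat.succ_le_of_lt h] using this
  -- Here the inserted `1` separates the two factors of the relation, so the scalar crosses it in
  -- two moves: `a r ⊗ 1 ⊗ b = a ⊗ r ⊗ b = a ⊗ 1 ⊗ r b`.
  · have h1 := S.word_rel (Nat.lt_succ_of_lt hl) c r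
    have h2 := S.word_rel (Nat.succ_lt_succ hl) c r
    rw [if_pos h.le, if_neg (by omega)]
    have h3 : c l = b l := by grind
    have h4 : c (l + 1) = 1 := by grind
    have h5 : c (l + 1 + 1) = b (l + 1) := by grind
    rw [h3, h4, mul_one] at h1
    rw [Nat.succ_eq_add_one, h4, h5, one_mul] at h2
    exact h1.trans h2
  · have h1 := S.word_rel (Nat.succ_lt_succ hl) c r
    rw [if_neg h.not_ge, if_neg (by omega)]
    have h3 : c (l + 1) = b l := by grind
    have h4 : c (l + 1 + 1) = b (l + 1) := by grind
    rwa [Nat.succ_eq_add_one, h3, h4] at h1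

variable (S)

/-- The degeneracy `a₀ ⊗ … ⊗ a_n ↦ a₀ ⊗ … ⊗ a_k ⊗ 1 ⊗ a_{k+1} ⊗ … ⊗ a_n`. -/
def degeneracy (n k : ℕ) : S.Chain n →+ S.Chain (n + 1) :=
  ((S.chainRel n).mapQ (S.chainRel (n + 1))
    (PiTensorProduct.lift (slotMultilinear (insertOne n k) insertOne_slot)) (by
    refine Submodule.span_le.2 ?_
    rintro _ ⟨l, a, r, rfl⟩
    rw [SetLike.mem_coe, Submodule.mem_comap, map_sub, ← Submodule.Quotient.eq,
      PiTensorProduct.lift.tprod, PiTensorProduct.lift.tprod]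
    exact S.chainMk_insertOne_rel l a r)).toAddMonoidHom

variable {S}

theorem degeneracy_word {n k : ℕ} (hk : k ≤ n) (a : ℕ → A) :
    S.degeneracy n k (S.word n a) = S.word (n + 1) fun j =>
      if j ≤ k then a j else if j = k + 1 then 1 else a (j - 1) := by
  refine (congrArg (S.chainRel (n + 1)).mkQ (PiTensorProduct.lift.tprod _)).trans
    (congrArg S.chainMk (funext fun j => ?_))
  simp only [insertOne]
  grind

end Superalgebra

end Words

/-! ### Junction operators -/

section Junction

variable {R : Type*} [Ring R] {𝓡 : ZMod 2 → AddSubgroup R}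
  {A : Type*} [Ring A] {𝓐 : ZMod 2 → AddSubgroup A} [GradedRing 𝓐]

/-! ### Total parities and Koszul signs. -/

theorem sum_range_merge {M : Type*} [AddCommMonoid M] (q : ℕ → M) {n i : ℕ} (hi : i ≤ n) :
    ∑ j ∈ Finset.range (n + 1), (if j < i then q j else if j = i then q j + q (j + 1)
      else q (j + 1)) = ∑ j ∈ Finset.range (n + 2), q j := by
  induction n with
  | zero =>
    obtain rfl : i = 0 := by omega
    simp [Finset.sum_range_succ]
  | succ n ih =>
    rcases Nat.lt_or_ge n i with h | h
    · obtain rfl : i = n + 1 := by omega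
      rw [Finset.sum_range_succ, if_neg (lt_irrefl _), if_pos rfl, Finset.sum_range_succ q (n + 2),
        Finset.sum_range_succ q (n + 1), ← add_assoc _ (q (n + 1))]
      congr 2
      exact Finset.sum_congr rfl fun j hj => by rw [if_pos (Finset.mem_range.1 hj)]
    · rw [Finset.sum_range_succ, ih h, if_neg (by omega), if_neg (by omega),
        Finset.sum_range_succ _ (n + 2)]

theorem sum_range_insert {M : Type*} [AddCommMonoid M] (q : ℕ → M) {n k : ℕ} (hk : k < n) :
    ∑ j ∈ Finset.range (n + 1), (if j ≤ k then q j else if j = k + 1 then 0 else q (j - 1))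
      = ∑ j ∈ Finset.range n, q j := by
  induction n with
  | zero => omega
  | succ n ih =>
    rcases Nat.lt_or_ge k n with h | h
    · rw [Finset.sum_range_succ, ih h, if_neg (by omega), if_neg (by omega),
        Finset.sum_range_succ _ n, Nat.add_sub_cancel]
    · obtain rfl : k = n := by omega
      rw [Finset.sum_range_succ, if_neg (by omega), if_pos rfl, add_zero]
      exact Finset.sum_congr rfl fun j hj => if_pos (Nat.lt_succ_iff.1 (Finset.mem_range.1 hj))

/-- A junction adds `p` to two entries, so the total parity is unchanged modulo 2. -/
theorem sum_range_junction {n j : ℕ} (hj : j < n) (p : ZMod 2) :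
    ∑ k ∈ Finset.range (n + 1), (if k = j then p else if k = j + 1 then p else 0) = 0 := by
  have h : ∀ k, (if k = j then p else if k = j + 1 then p else 0)
      = (if k = j then p else 0) + if k = j + 1 then p else 0 := by
    intro k
    rcases eq_or_ne k j with rfl | h <;> simp [*]
  simp only [h, Finset.sum_add_distrib, Finset.sum_ite_eq', Finset.mem_range]
  rw [if_pos (by omega), if_pos (by omega), CharTwo.add_self_eq_zero]

/-- The range stops between the two altered entries. This is the sum met by the cyclic face when the
junction sits just before the last entry. -/
theorem sum_range_junction_self (j : ℕ) (p : ZMod 2) :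
    ∑ k ∈ Finset.range (j + 1), (if k = j then p else if k = j + 1 then p else 0) = p := by
  rw [Finset.sum_eq_single_of_mem j (by simp), if_pos rfl]
  intro k hk hkj
  rw [if_neg hkj, if_neg (by simp at hk; omega)]

theorem sum_range_zero (n : ℕ) (p : ZMod 2) :
    ∑ k ∈ Finset.range (n + 1), (if k = 0 then p else 0) = p := by
  simp

/-- Expand `(q + p)(s + p)` and use `p² = p`; the square accounts for the `1` on the right. Here `q`
is the parity of the last entry and `s` that of all the others. -/
theorem superSign_mul_junction (p q s : ZMod 2) :
    superSign (q + p) (s + p) = superSign q s * superSign p (1 + (s + q)) := by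
  revert p q s; decide

theorem superSign_junction_cancel (p q s : ZMod 2) :
    superSign p (1 + (s + q)) * superSign (q + p) (s + p) = superSign q s := by
  revert p q s; decide

theorem faceSeq_mem {a : ℕ → A} {q : ℕ → ZMod 2} (ha : ∀ j, a j ∈ 𝓐 (q j)) (i j : ℕ) :
    (if j < i then a j else if j = i then a j * a (j + 1) else a (j + 1)) ∈
      𝓐 (if j < i then q j else if j = i then q j + q (j + 1) else q (j + 1)) := by
  split_ifs
  exacts [ha _, SetLike.mul_mem_graded (ha _) (ha _), ha _]

namespace Superalgebra

variable (S : Superalgebra 𝓡 𝓐)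

theorem mul_toRingHom_of_mem {i p : ZMod 2} {r : R} {x : A} (hr : r ∈ 𝓡 i) (hx : x ∈ 𝓐 p) :
    x * S.toRingHom r = superSign i p • (S.toRingHom r * x) := by
  rw [S.supercentral hr hx, smul_smul, superSign_mul_self, one_smul]

/-- The action on the `k`-th factor of the junction operator. -/
def junctionSlot (𝓐 : ZMod 2 → AddSubgroup A) [GradedRing 𝓐] (n j : ℕ) (p : ZMod 2) (x y : A)
    (k : ℕ) : A →+ A :=
  if j < n then
    if k = j then AddMonoidHom.mulRight y else if k = j + 1 then AddMonoidHom.mulLeft x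
      else AddMonoidHom.id A
  else ((if k = n then AddMonoidHom.mulRight y else AddMonoidHom.id A).comp
    (if k = 0 then AddMonoidHom.mulLeft x else AddMonoidHom.id A)).comp (superTwist 𝓐 p)

/-- At an inner gap the scalar passes `y` on one side and `x` on the other. The signs agree because
`x` and `y` have the same parity. For the cyclic gap every slot is twisted by `p`, so both sides
pick up the sign of the twist on the scalar. -/
theorem junctionSlot_balanced {n j : ℕ} {p : ZMod 2} {x y : A} (hx : x ∈ 𝓐 p) (hy : y ∈ 𝓐 p)
    {l : ℕ} (hl : l < n) {i : ZMod 2} {r : R} (hr : r ∈ 𝓡 i) : ∃ c : ℤ,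
      (∀ a, junctionSlot 𝓐 n j p x y l (a * S.toRingHom r)
        = c • (junctionSlot 𝓐 n j p x y l a * S.toRingHom r)) ∧
      ∀ a, junctionSlot 𝓐 n j p x y (l + 1) (S.toRingHom r * a)
        = c • (S.toRingHom r * junctionSlot 𝓐 n j p x y (l + 1) a) := by
  by_cases hj : j < n
  · simp only [junctionSlot, if_pos hj]
    by_cases h : l = j
    · subst h
      refine ⟨superSign i p, fun a => ?_, fun a => ?_⟩
      · simp [-zsmul_eq_mul, mul_assoc, S.supercentral hr hy]
      · simp [-zsmul_eq_mul, ← mul_assoc, S.mul_toRingHom_of_mem hr hx]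
    · refine ⟨1, fun a => ?_, fun a => ?_⟩
      · rw [if_neg h]
        split_ifs <;> simp [mul_assoc]
      · rw [if_neg (show l + 1 ≠ j + 1 by omega)]
        split_ifs <;> simp [mul_assoc]
  -- Slot `l` is not the last and slot `l + 1` is not the first, so the scalar never meets `x` or
  -- `y`; only the twist contributes.
  · simp only [junctionSlot, if_neg hj, if_neg hl.ne, if_neg (Nat.succ_ne_zero l)]
    refine ⟨superSign p i, fun a => ?_, fun a => ?_⟩
    · split_ifs <;> simp [-zsmul_eq_mul, superTwist_mul, S.superTwist_toRingHom hr, mul_assoc]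
    · split_ifs <;> simp [-zsmul_eq_mul, superTwist_mul, S.superTwist_toRingHom hr, mul_assoc]

/-- The junction operator
`a₀ ⊗ … ⊗ a_n ↦ a₀ ⊗ … ⊗ a_j y ⊗ x a_{j+1} ⊗ … ⊗ a_n` for `j < n`, and its cyclic analogue
`a₀ ⊗ … ⊗ a_n ↦ ± x a₀ ⊗ … ⊗ a_n y` for `j = n`. -/
def junction [GradedRing 𝓡] (n j : ℕ) {p : ZMod 2} (x y : 𝓐 p) : S.Chain n →+ S.Chain n :=
  (if j < n then 1 else superSign p 1) •
    slotMap (S := S) (S' := S) (junctionSlot 𝓐 n j p x y)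
      (fun _ hl _ _ hr => S.junctionSlot_balanced x.2 y.2 hl hr)

variable {S}

theorem word_smul_congr {n : ℕ} {a b : ℕ → A} {c d : ℤ} (hc : c = d) (h : ∀ j ≤ n, a j = b j) :
    c • S.word n a = d • S.word n b := by
  rw [hc, word_congr h]

variable [GradedRing 𝓡]

theorem junction_word {n j : ℕ} (hj : j < n) {p : ZMod 2} (x y : 𝓐 p) (a : ℕ → A) :
    S.junction n j x y (S.word n a) = S.word n fun k =>
      if k = j then a k * y else if k = j + 1 then x * a k else a k := by
  rw [junction, if_pos hj, one_smul, slotMap_word]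
  congr 1
  funext k
  simp only [junctionSlot, if_pos hj]
  split_ifs <;> rfl

/-- The twists contribute the Koszul sign of `p` against the total parity. The extra `1` is the
normalising factor in `junction`, chosen so that the cyclic face turns an inner junction into the
cyclic one. -/
theorem junction_last_word (n : ℕ) {p : ZMod 2} (x y : 𝓐 p) (a : ℕ → A) {q : ℕ → ZMod 2}
    (ha : ∀ j, a j ∈ 𝓐 (q j)) :
    S.junction n n x y (S.word n a)
      = superSign p (1 + ∑ j ∈ Finset.range (n + 1), q j) • S.word n fun k =>
        if k = n then (if k = 0 then x * a k else a k) * y else if k = 0 then x * a k else a k := by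
  rw [junction, if_neg (lt_irrefl n), AddMonoidHom.smul_apply, slotMap_word, superSign_add_right,
    mul_smul, superSign_sum, Finset.prod_range]
  congr 1
  refine Eq.trans ?_ (congrArg (S.chainRel n).mkQ (MultilinearMap.map_smul_univ
    (PiTensorProduct.tprod ℤ) (fun j : Fin (n + 1) => superSign p (q j)) _))
  refine congrArg S.chainMk (funext fun k => ?_)
  simp only [junctionSlot, if_neg (lt_irrefl n), AddMonoidHom.comp_apply,
    superTwist_of_mem p (ha _)]
  split_ifs <;> simp [-zsmul_eq_mul, mul_assoc]

/-- Closing an earlier gap lowers the number of the gap carrying the junction by one. -/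
theorem faceHom_junction_succ {n i j : ℕ} (hij : i ≤ j) (hj : j ≤ n) {p : ZMod 2} (x y : 𝓐 p) :
    (S.faceHom n i).comp (S.junction (n + 1) (j + 1) x y)
      = (S.junction n j x y).comp (S.faceHom n i) := by
  refine chain_hom_ext fun a q ha => ?_
  rw [AddMonoidHom.comp_apply, AddMonoidHom.comp_apply, faceHom_word (hij.trans hj)]
  rcases hj.lt_or_eq with h | rfl
  · rw [junction_word (Nat.succ_lt_succ h), junction_word h, faceHom_word (hij.trans hj)]
    refine word_congr fun k hk => ?_
    grind
  · rw [junction_last_word _ x y a ha, junction_last_word _ x y _ (faceSeq_mem ha i), map_zsmul,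
      faceHom_word hij, sum_range_merge q hij]
    refine word_smul_congr rfl fun k hk => ?_
    grind

/-- Closing a later gap leaves the number of the junction unchanged. The delicate case is `i = n +
1`, `j = n`: the last entry moves to the front, carrying `x` with it, and an inner junction becomes
cyclic. -/
theorem faceHom_junction_of_lt {n i j : ℕ} (hij : j < i) (hi : i ≤ n + 1) {p : ZMod 2}
    (x y : 𝓐 p) :
    (S.faceHom n i).comp (S.junction (n + 1) j x y)
      = (S.junction n j x y).comp (S.faceHom n i) := by
  refine chain_hom_ext fun a q ha => ?_
  rw [AddMonoidHom.comp_apply, AddMonoidHom.comp_apply, junction_word (hij.trans_le hi)]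
  rcases Nat.lt_or_ge n i with h | h
  · obtain rfl : i = n + 1 := by omega
    have hb : ∀ k, (if k = j then a k * (y : A) else if k = j + 1 then x * a k else a k) ∈
        𝓐 (q k + if k = j then p else if k = j + 1 then p else 0) := by
      intro k
      split_ifs
      · exact SetLike.mul_mem_graded (ha _) y.2
      · rw [add_comm]
        exact SetLike.mul_mem_graded x.2 (ha _)
      · rw [add_zero]
        exact ha _
    have hc : ∀ k, (if k = 0 then a (n + 1) * a 0 else a k) ∈
        𝓐 (q k + if k = 0 then q (n + 1) else 0) := by
      intro k
      split_ifs with h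
      · subst h
        rw [add_comm]
        exact SetLike.mul_mem_graded (ha _) (ha _)
      · rw [add_zero]
        exact ha _
    rw [faceHom_last_word _ _ hb, faceHom_last_word _ _ ha, map_zsmul]
    simp only [Finset.sum_add_distrib]
    rcases (Nat.lt_succ_iff.1 hij).lt_or_eq with h' | rfl
    · rw [junction_word h']
      refine word_smul_congr ?_ fun k hk => ?_
      · rw [if_neg (by omega), if_neg (by omega), add_zero, sum_range_junction h', add_zero]
      · grind
    -- Both sides give `x a_{n+1} a₀ ⊗ … ⊗ a_n y`, and the signs agree by `superSign_mul_junction`.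
    · rw [junction_last_word _ x y _ hc, smul_smul]
      simp only [Finset.sum_add_distrib]
      refine word_smul_congr ?_ fun k hk => ?_
      · rw [if_neg (by omega), if_pos trivial, sum_range_junction_self, sum_range_zero,
          superSign_mul_junction]
      · grind [mul_assoc]
  · rw [faceHom_word h, faceHom_word h, junction_word (hij.trans_le h)]
    refine word_congr fun k hk => ?_
    grind [mul_assoc]

/-- The face at the gap of the junction multiplies `y_t` by `x_t`, and the sum over `t` is then
absorbed. For the cyclic face the two signs combine to one that does not depend on `t`, so it can be
pulled out before summing. -/
theorem sum_faceHom_junction {n i : ℕ} (hi : i ≤ n + 1) {J : Type*} [Fintype J] {p : J → ZMod 2}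
    (x y : ∀ t, 𝓐 (p t)) (h : ∑ t, (y t : A) * x t = 1) :
    ∑ t, (S.faceHom n i).comp (S.junction (n + 1) i (x t) (y t)) = S.faceHom n i := by
  refine chain_hom_ext fun a q ha => ?_
  rw [AddMonoidHom.finsetSum_apply]
  simp only [AddMonoidHom.comp_apply]
  rcases Nat.lt_or_ge n i with h' | h'
  · obtain rfl : i = n + 1 := by omega
    have hb : ∀ t k, (if k = n + 1 then (if k = 0 then x t * a k else a k) * (y t : A)
        else if k = 0 then x t * a k else a k) ∈
        𝓐 (q k + if k = n + 1 then p t else if k = 0 then p t else 0) := by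
      intro t k
      split_ifs with h1 h2
      · omega
      · exact SetLike.mul_mem_graded (ha _) (y t).2
      · rw [add_comm]
        exact SetLike.mul_mem_graded (x t).2 (ha _)
      · rw [add_zero]
        exact ha _
    set b : ℕ → A := fun j => if j = 0 then a (n + 1) * a 0 else a j with hb'
    have e : ∀ t, S.faceHom n (n + 1) (S.junction (n + 1) (n + 1) (x t) (y t) (S.word (n + 1) a))
        = superSign (q (n + 1)) (∑ j ∈ Finset.range (n + 1), q j) •
          S.word n (Function.update b 0 (a (n + 1) * (y t * x t) * a 0)) := by
      intro t
      -- The range omits the last entry, which carries `y_t`, so only `x_t` at entry `0` is counted.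
      have hs : ∑ k ∈ Finset.range (n + 1), (if k = n + 1 then p t else if k = 0 then p t else 0)
          = p t := by
        rw [← sum_range_zero n (p t)]
        refine Finset.sum_congr rfl fun k hk => ?_
        rw [if_neg (by simp at hk; omega)]
        simp
      rw [junction_last_word _ _ _ _ ha, map_zsmul, faceHom_last_word _ _ (hb t), smul_smul,
        Finset.sum_range_succ _ (n + 1)]
      simp only [Finset.sum_add_distrib, hs, if_true]
      refine word_smul_congr (superSign_junction_cancel _ _ _) fun k hk => ?_
      rcases eq_or_ne k 0 with rfl | hk0
      · simp [mul_assoc]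
      · rw [Function.update_of_ne hk0, if_neg hk0, if_neg (by omega), if_neg hk0, hb']
        simp [hk0]
    simp only [e]
    rw [faceHom_last_word _ _ ha, ← Finset.smul_sum, ← word_sum _ (Nat.zero_le n),
      ← Finset.sum_mul, ← Finset.mul_sum, h, mul_one]
    congr 2
    exact Function.update_eq_self 0 b
  · set b : ℕ → A := fun j =>
      if j < i then a j else if j = i then a j * a (j + 1) else a (j + 1) with hb
    have e : ∀ t, S.faceHom n i (S.junction (n + 1) i (x t) (y t) (S.word (n + 1) a))
        = S.word n (Function.update b i (a i * (y t * x t) * a (i + 1))) := by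
      intro t
      rw [junction_word (Nat.lt_succ_of_le h'), faceHom_word h']
      refine word_congr fun k hk => ?_
      rcases eq_or_ne k i with rfl | hki
      · simp [mul_assoc]
      · rw [Function.update_of_ne hki]
        grind
    simp only [e]
    rw [faceHom_word h', ← word_sum _ h', ← Finset.sum_mul, ← Finset.mul_sum, h, mul_one]
    congr 1
    have : a i * a (i + 1) = b i := by simp [hb]
    rw [this, Function.update_eq_self]

/-! ### Simplicial identities between faces and degeneracies. -/

theorem one_mem_seq {a : ℕ → A} {q : ℕ → ZMod 2} (ha : ∀ j, a j ∈ 𝓐 (q j)) (k j : ℕ) :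
    (if j ≤ k then a j else if j = k + 1 then 1 else a (j - 1)) ∈
      𝓐 (if j ≤ k then q j else if j = k + 1 then 0 else q (j - 1)) := by
  split_ifs
  exacts [ha _, SetLike.one_mem_graded 𝓐, ha _]

theorem faceHom_degeneracy_of_lt {n i k : ℕ} (hik : i < k) (hk : k ≤ n + 1) :
    (S.faceHom (n + 1) i).comp (S.degeneracy (n + 1) k)
      = (S.degeneracy n (k - 1)).comp (S.faceHom n i) := by
  refine chain_hom_ext fun a q ha => ?_
  rw [AddMonoidHom.comp_apply, AddMonoidHom.comp_apply, degeneracy_word hk,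
    faceHom_word (by omega), faceHom_word (by omega), degeneracy_word (by omega)]
  refine word_congr fun j hj => ?_
  grind

theorem faceHom_degeneracy_self {n k : ℕ} (hk : k ≤ n) :
    (S.faceHom n k).comp (S.degeneracy n k) = AddMonoidHom.id _ := by
  refine chain_hom_ext fun a q ha => ?_
  rw [AddMonoidHom.comp_apply, degeneracy_word hk, faceHom_word hk]
  refine word_congr fun j hj => ?_
  grind

theorem faceHom_succ_degeneracy {n k : ℕ} (hk : k ≤ n) :
    (S.faceHom n (k + 1)).comp (S.degeneracy n k) = AddMonoidHom.id _ := by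
  refine chain_hom_ext fun a q ha => ?_
  rw [AddMonoidHom.comp_apply, degeneracy_word hk]
  rcases hk.lt_or_eq with h | rfl
  · rw [faceHom_word h]
    refine word_congr fun j hj => ?_
    grind
  · rw [faceHom_last_word _ _ (one_mem_seq ha k), if_neg (by omega), if_pos rfl,
      AddMonoidHom.id_apply]
    -- The cyclic face moves the inserted `1`, which is even, so no sign appears.
    have : ∀ s, superSign 0 s = 1 := by decide
    rw [this, one_smul]
    refine word_congr fun j hj => ?_
    grind

theorem faceHom_degeneracy_of_gt {n i k : ℕ} (hik : k + 1 < i) (hi : i ≤ n + 2) :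
    (S.faceHom (n + 1) i).comp (S.degeneracy (n + 1) k)
      = (S.degeneracy n k).comp (S.faceHom n (i - 1)) := by
  refine chain_hom_ext fun a q ha => ?_
  rw [AddMonoidHom.comp_apply, AddMonoidHom.comp_apply, degeneracy_word (by omega)]
  rcases hi.lt_or_eq with h | rfl
  · rw [faceHom_word (by omega), faceHom_word (by omega), degeneracy_word (by omega)]
    refine word_congr fun j hj => ?_
    grind
  · rw [faceHom_last_word _ _ (one_mem_seq ha k), Nat.add_sub_cancel, faceHom_last_word _ _ ha,
      map_zsmul, degeneracy_word (by omega)]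
    refine word_smul_congr ?_ fun j hj => ?_
    · rw [if_neg (by omega), if_neg (by omega), sum_range_insert q (by omega)]
    · grind

end Superalgebra

end Junction

/-! ### The homotopy between the junction operator and the identity -/

/-- The alternating sum of the faces of one homotopy operator, cut at the indices `k` and `k + 1`.
The terms below and above are lower homotopy operators applied to faces; the shift `i ↦ i - 1`
reverses the signs of the upper ones. -/
theorem sum_homotopy_column {G : Type*} [AddCommGroup G] {n k : ℕ} (hk : k ≤ n) (F L U : ℕ → G)
    (p : ℕ → G) (hL : ∀ i < k, F i = L i) (hk0 : F k = p k) (hk1 : F (k + 1) = p (k + 1))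
    (hU : ∀ i, k + 1 < i → i < n + 2 → F i = U (i - 1)) :
    ∑ i ∈ Finset.range (n + 2), (-1 : ℤ) ^ i • F i
      = ∑ i ∈ Finset.range k, (-1 : ℤ) ^ i • L i + (-1 : ℤ) ^ k • (p k - p (k + 1))
        - ∑ i ∈ Finset.Ico (k + 1) (n + 1), (-1 : ℤ) ^ i • U i := by
  rw [Finset.range_eq_Ico, ← Finset.sum_Ico_consecutive _ (Nat.zero_le k) (by omega : k ≤ n + 2),
    ← Finset.sum_Ico_consecutive _ (Nat.le_add_right k 2) (by omega : k + 2 ≤ n + 2),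
    ← Finset.sum_Ico_add' _ (k + 1) (n + 1) 1, Finset.range_eq_Ico]
  have e1 : ∑ i ∈ Finset.Ico 0 k, (-1 : ℤ) ^ i • F i
      = ∑ i ∈ Finset.Ico 0 k, (-1 : ℤ) ^ i • L i :=
    Finset.sum_congr rfl fun i hi => by rw [hL i (Finset.mem_Ico.1 hi).2]
  have e2 : ∑ i ∈ Finset.Ico k (k + 2), (-1 : ℤ) ^ i • F i
      = (-1 : ℤ) ^ k • (p k - p (k + 1)) := by
    rw [Finset.sum_Ico_succ_top (by omega), Finset.sum_Ico_succ_top (by omega), Finset.Ico_self,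
      Finset.sum_empty, zero_add, hk0, hk1, pow_succ, smul_sub, mul_neg_one, neg_smul,
      sub_eq_add_neg]
  have e3 : ∑ i ∈ Finset.Ico (k + 1) (n + 1), (-1 : ℤ) ^ (i + 1) • F (i + 1)
      = - ∑ i ∈ Finset.Ico (k + 1) (n + 1), (-1 : ℤ) ^ i • U i := by
    rw [← Finset.sum_neg_distrib]
    refine Finset.sum_congr rfl fun i hi => ?_
    have := Finset.mem_Ico.1 hi
    rw [hU (i + 1) (by omega) (by omega), Nat.add_sub_cancel, pow_succ, mul_neg_one, neg_smul]
  rw [e1, e2, e3, ← add_assoc, ← sub_eq_add_neg]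

/-- The passage from a simplicial homotopy to a chain homotopy, for `F i k = d_i h_k z` and `L i k =
h_k d_i z`. The middle terms telescope from `p 0` to `p (n + 1)` and all others cancel. The
subtraction in `k - 1` is genuine, since it occurs only with `i < k`. -/
theorem sum_homotopy {G : Type*} [AddCommGroup G] {n : ℕ} (F : ℕ → ℕ → G) (L : ℕ → ℕ → G)
    (p : ℕ → G) (hL : ∀ k ≤ n, ∀ i < k, F i k = L i (k - 1)) (hk0 : ∀ k ≤ n, F k k = p k)
    (hk1 : ∀ k ≤ n, F (k + 1) k = p (k + 1))
    (hU : ∀ k ≤ n, ∀ i, k + 1 < i → i < n + 2 → F i k = L (i - 1) k) :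
    ∑ k ∈ Finset.range (n + 1), (-1 : ℤ) ^ k • ∑ i ∈ Finset.range (n + 2), (-1 : ℤ) ^ i • F i k
      + ∑ k ∈ Finset.range n, (-1 : ℤ) ^ k • ∑ i ∈ Finset.range (n + 1), (-1 : ℤ) ^ i • L i k
      = p 0 - p (n + 1) := by
  have h : ∀ k ∈ Finset.range (n + 1),
      (-1 : ℤ) ^ k • ∑ i ∈ Finset.range (n + 2), (-1 : ℤ) ^ i • F i k
      = (-1 : ℤ) ^ k • ∑ i ∈ Finset.range k, (-1 : ℤ) ^ i • L i (k - 1) + (p k - p (k + 1))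
        - (-1 : ℤ) ^ k • ∑ i ∈ Finset.Ico (k + 1) (n + 1), (-1 : ℤ) ^ i • L i k := by
    intro k hk
    have hk := Nat.lt_succ_iff.1 (Finset.mem_range.1 hk)
    rw [sum_homotopy_column hk (F · k) (L · (k - 1)) (L · k) p (hL k hk) (hk0 k hk) (hk1 k hk)
      (hU k hk), smul_sub, smul_add, smul_smul, ← pow_add, Even.neg_one_pow ⟨k, rfl⟩, one_smul]
  rw [Finset.sum_congr rfl h, Finset.sum_sub_distrib, Finset.sum_add_distrib,
    Finset.sum_range_sub', Finset.sum_range_succ', Finset.sum_range_succ _ n, Finset.Ico_self]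
  simp only [Finset.range_zero, Finset.sum_empty, smul_zero, add_zero, Nat.add_sub_cancel]
  -- Each row of `h d` is cut at `i = k`, to match the parts of the columns above and below the
  -- diagonal; the lower part is matched with column `k + 1`.
  have h' : ∀ k ∈ Finset.range n,
      (-1 : ℤ) ^ k • ∑ i ∈ Finset.range (n + 1), (-1 : ℤ) ^ i • L i k
      = (-1 : ℤ) ^ k • ∑ i ∈ Finset.Ico (k + 1) (n + 1), (-1 : ℤ) ^ i • L i k
        - (-1 : ℤ) ^ (k + 1) • ∑ i ∈ Finset.range (k + 1), (-1 : ℤ) ^ i • L i k := by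
    intro k hk
    have hk := Finset.mem_range.1 hk
    rw [Finset.range_eq_Ico, Finset.range_eq_Ico, ← Finset.sum_Ico_consecutive _
      (Nat.zero_le (k + 1)) (by omega : k + 1 ≤ n + 1), smul_add, pow_succ, mul_neg_one, neg_smul, sub_neg_eq_add,
      add_comm]
  rw [Finset.sum_congr rfl h', Finset.sum_sub_distrib]
  abel

section Homotopy

variable {R : Type*} [Ring R] {𝓡 : ZMod 2 → AddSubgroup R} [GradedRing 𝓡]
  {A : Type*} [Ring A] {𝓐 : ZMod 2 → AddSubgroup A} [GradedRing 𝓐]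

namespace Superalgebra

variable (S : Superalgebra 𝓡 𝓐) {J : Type*} [Fintype J] {p : J → ZMod 2}

/-- The composite of the first `k` junction operators, each summed over a family of pairs. -/
def iterJunction (x y : ∀ t, 𝓐 (p t)) (n : ℕ) : ℕ → S.Chain n →+ S.Chain n
  | 0 => AddMonoidHom.id _
  | k + 1 => (iterJunction x y n k).comp (∑ t, S.junction n k (x t) (y t))

/-- The simplicial homotopy operators from the identity to the full junction operator. -/
def junctionHomotopy (x y : ∀ t, 𝓐 (p t)) (n k : ℕ) : S.Chain n →+ S.Chain (n + 1) :=
  (S.iterJunction x y (n + 1) (k + 1)).comp (S.degeneracy n k)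

variable {S} {x y : ∀ t, 𝓐 (p t)}

/-- The filled gaps are `0, …, k - 1`, all before the gap being closed, so their numbers do not
change. -/
theorem faceHom_iterJunction_of_le {n i k : ℕ} (hk : k ≤ i) (hi : i ≤ n + 1)
    (z : S.Chain (n + 1)) :
    S.faceHom n i (S.iterJunction x y (n + 1) k z) = S.iterJunction x y n k (S.faceHom n i z) := by
  induction k generalizing z with
  | zero => rfl
  | succ k ih =>
    simp only [iterJunction, AddMonoidHom.comp_apply]
    rw [ih (by omega), AddMonoidHom.finsetSum_apply, AddMonoidHom.finsetSum_apply, map_sum]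
    congr 1
    exact Finset.sum_congr rfl fun t _ =>
      DFunLike.congr_fun (faceHom_junction_of_lt (Nat.lt_of_succ_le hk) hi (x t) (y t)) z

/-- The gap being closed is one of the `k + 1` filled ones. Its junction is absorbed and `k` filled
gaps remain. -/
theorem faceHom_iterJunction_of_gt (h : ∑ t, (y t : A) * x t = 1) {n i k : ℕ} (hi : i ≤ k)
    (hk : k ≤ n + 1) (z : S.Chain (n + 1)) :
    S.faceHom n i (S.iterJunction x y (n + 1) (k + 1) z)
      = S.iterJunction x y n k (S.faceHom n i z) := by
  induction k generalizing z with
  | zero =>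
    obtain rfl : i = 0 := by omega
    simp only [iterJunction, AddMonoidHom.comp_apply, AddMonoidHom.id_apply]
    conv_rhs => rw [← sum_faceHom_junction (Nat.zero_le _) x y h]
    rw [AddMonoidHom.finsetSum_apply, AddMonoidHom.finsetSum_apply, map_sum]
    rfl
  | succ k ih =>
    rw [iterJunction, AddMonoidHom.comp_apply]
    rcases hi.lt_or_eq with h' | rfl
    · rw [ih (by omega) (by omega), iterJunction, AddMonoidHom.comp_apply,
        AddMonoidHom.finsetSum_apply, AddMonoidHom.finsetSum_apply, map_sum]
      congr 1
      exact Finset.sum_congr rfl fun t _ =>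
        DFunLike.congr_fun (faceHom_junction_succ (by omega) (by omega) (x t) (y t)) z
    · rw [faceHom_iterJunction_of_le le_rfl hk]
      conv_rhs => rw [← sum_faceHom_junction hk x y h]
      rw [AddMonoidHom.finsetSum_apply, AddMonoidHom.finsetSum_apply, map_sum]
      rfl

/-- The full junction operator commutes with the differential. -/
theorem d_iterJunction (h : ∑ t, (y t : A) * x t = 1) {n : ℕ} (z : S.Chain (n + 1)) :
    S.d n (S.iterJunction x y (n + 1) (n + 2) z) = S.iterJunction x y n (n + 1) (S.d n z) := by
  rw [d_eq_sum_faceHom, d_eq_sum_faceHom, map_sum]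
  refine Finset.sum_congr rfl fun i hi => ?_
  rw [faceHom_iterJunction_of_gt h (Nat.lt_succ_iff.1 (Finset.mem_range.1 hi)) le_rfl, map_zsmul]

/-- The degeneracy splits gap `k` into a filled gap `k` and an empty gap `k + 1`. Closing the filled
one leaves `k` junctions, whereas closing the empty one, as in the next lemma, leaves `k + 1`.
Consecutive homotopy operators therefore share an end. -/
theorem faceHom_junctionHomotopy_self (h : ∑ t, (y t : A) * x t = 1) {n k : ℕ} (hk : k ≤ n)
    (z : S.Chain n) : S.faceHom n k (S.junctionHomotopy x y n k z) = S.iterJunction x y n k z := by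
  rw [junctionHomotopy, AddMonoidHom.comp_apply, faceHom_iterJunction_of_gt h le_rfl (by omega)]
  exact congrArg _ (DFunLike.congr_fun (faceHom_degeneracy_self hk) z)

theorem faceHom_junctionHomotopy_succ {n k : ℕ} (hk : k ≤ n) (z : S.Chain n) :
    S.faceHom n (k + 1) (S.junctionHomotopy x y n k z) = S.iterJunction x y n (k + 1) z := by
  rw [junctionHomotopy, AddMonoidHom.comp_apply, faceHom_iterJunction_of_le le_rfl (by omega)]
  exact congrArg _ (DFunLike.congr_fun (faceHom_succ_degeneracy hk) z)

theorem faceHom_junctionHomotopy_of_lt (h : ∑ t, (y t : A) * x t = 1) {n i k : ℕ} (hi : i < k)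
    (hk : k ≤ n + 1) (z : S.Chain (n + 1)) :
    S.faceHom (n + 1) i (S.junctionHomotopy x y (n + 1) k z)
      = S.junctionHomotopy x y n (k - 1) (S.faceHom n i z) := by
  rw [junctionHomotopy, AddMonoidHom.comp_apply, faceHom_iterJunction_of_gt h hi.le (by omega),
    junctionHomotopy, Nat.sub_add_cancel (by omega)]
  exact congrArg _ (DFunLike.congr_fun (faceHom_degeneracy_of_lt hi hk) z)

theorem faceHom_junctionHomotopy_of_gt {n i k : ℕ} (hi : k + 1 < i)
    (hk : i ≤ n + 2) (z : S.Chain (n + 1)) :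
    S.faceHom (n + 1) i (S.junctionHomotopy x y (n + 1) k z)
      = S.junctionHomotopy x y n k (S.faceHom n (i - 1) z) := by
  rw [junctionHomotopy, AddMonoidHom.comp_apply, faceHom_iterJunction_of_le hi.le hk,
    junctionHomotopy]
  exact congrArg _ (DFunLike.congr_fun (faceHom_degeneracy_of_gt hi hk) z)

/-- The full junction operator acts as the identity on homology. -/
theorem sub_iterJunction_mem_boundaries (h : ∑ t, (y t : A) * x t = 1) {n : ℕ} {z : S.Chain n}
    (hz : z ∈ S.cycles n) : z - S.iterJunction x y n (n + 1) z ∈ S.boundaries n := by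
  refine ⟨∑ k ∈ Finset.range (n + 1), (-1 : ℤ) ^ k • S.junctionHomotopy x y n k z, ?_⟩
  rw [map_sum]
  simp only [map_zsmul, d_eq_sum_faceHom]
  cases n with
  | zero =>
    -- In degree zero there is no `h d` term; the conditions on `L` are vacuous, so `0` serves.
    have := sum_homotopy (n := 0) (fun i k => S.faceHom 0 i (S.junctionHomotopy x y 0 k z))
      (fun _ _ => 0) (fun k => S.iterJunction x y 0 k z) (by omega)
      (fun k hk => faceHom_junctionHomotopy_self h hk z)
      (fun k hk => faceHom_junctionHomotopy_succ hk z) (by omega)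
    simp only [smul_zero, Finset.sum_const_zero, add_zero] at this
    exact this
  | succ n =>
    have := sum_homotopy (n := n + 1)
      (fun i k => S.faceHom (n + 1) i (S.junctionHomotopy x y (n + 1) k z))
      (fun i k => S.junctionHomotopy x y n k (S.faceHom n i z))
      (fun k => S.iterJunction x y (n + 1) k z)
      (fun k hk i hi => faceHom_junctionHomotopy_of_lt h hi hk z)
      (fun k hk => faceHom_junctionHomotopy_self h hk z)
      (fun k hk => faceHom_junctionHomotopy_succ hk z)
      (fun k hk i hi hi' => faceHom_junctionHomotopy_of_gt hi (by omega) z)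
    have hz' : ∑ i ∈ Finset.range (n + 2), (-1 : ℤ) ^ i • S.faceHom n i z = 0 := by
      rw [← d_eq_sum_faceHom]
      exact hz
    -- The `h d` term vanishes on a cycle.
    have e : ∑ k ∈ Finset.range (n + 1), (-1 : ℤ) ^ k • ∑ i ∈ Finset.range (n + 2),
        (-1 : ℤ) ^ i • S.junctionHomotopy x y n k (S.faceHom n i z) = 0 := by
      refine Finset.sum_eq_zero fun k _ => ?_
      rw [← smul_zero ((-1 : ℤ) ^ k), ← map_zero (S.junctionHomotopy x y n k), ← hz', map_sum]
      simp only [map_zsmul]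
    rw [e, add_zero] at this
    exact this

end Superalgebra

end Homotopy

/-! ### Full corners of superalgebras -/

section Corner

variable {R : Type*} [Ring R] {𝓡 : ZMod 2 → AddSubgroup R}
  {A : Type*} [Ring A] {𝓐 : ZMod 2 → AddSubgroup A} [GradedRing 𝓐]
  {L : Type*} [Ring L] {𝓛 : ZMod 2 → AddSubgroup L} [GradedRing 𝓛]

namespace Superalgebra

/-! ### Parity of the chain operators. -/

theorem word_mem_chainGrading {S : Superalgebra 𝓡 𝓐} (n : ℕ) {a : ℕ → A} {q : ℕ → ZMod 2}
    (ha : ∀ j, a j ∈ 𝓐 (q j)) :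
    S.word n a ∈ S.chainGrading n (∑ j ∈ Finset.range (n + 1), q j) :=
  AddSubgroup.subset_closure ⟨fun j => q j, fun j => a j, fun j => ha j,
    (Finset.sum_range _).symm, rfl⟩

theorem map_mem_chainGrading {S : Superalgebra 𝓡 𝓐} {T : Superalgebra 𝓡 𝓛} {m n : ℕ}
    (f : S.Chain m →+ T.Chain n)
    (hf : ∀ (a : ℕ → A) (q : ℕ → ZMod 2), (∀ j, a j ∈ 𝓐 (q j)) →
      f (S.word m a) ∈ T.chainGrading n (∑ j ∈ Finset.range (m + 1), q j))
    {k : ZMod 2} {x : S.Chain m} (hx : x ∈ S.chainGrading m k) : f x ∈ T.chainGrading n k := by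
  induction hx using AddSubgroup.closure_induction with
  | mem x hx =>
    obtain ⟨q, a, ha, rfl, rfl⟩ := hx
    have h := hf (fun j => if h : j < m + 1 then a ⟨j, h⟩ else 0)
      (fun j => if h : j < m + 1 then q ⟨j, h⟩ else 0) fun j => by
        split_ifs
        exacts [ha _, zero_mem _]
    rw [← word_fin, Finset.sum_range] at h
    simpa only [Fin.is_lt, dite_true] using h
  | zero => rw [map_zero]; exact zero_mem _
  | add x y _ _ hx hy => rw [map_add]; exact add_mem hx hy
  | neg x _ hx => rw [map_neg]; exact neg_mem hx

section

variable [GradedRing 𝓡]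

/-- The two inserted elements have equal parity, so their contributions to the total cancel. For `n
= 0` both land on the single entry. -/
theorem junction_mem_chainGrading {S : Superalgebra 𝓡 𝓐} {n j : ℕ} (hj : j ≤ n) {p : ZMod 2}
    (x y : 𝓐 p) {k : ZMod 2} {z : S.Chain n} (hz : z ∈ S.chainGrading n k) :
    S.junction n j x y z ∈ S.chainGrading n k := by
  refine map_mem_chainGrading _ (fun a q ha => ?_) hz
  rcases hj.lt_or_eq with h | rfl
  · have hb : ∀ k, (if k = j then a k * (y : A) else if k = j + 1 then x * a k else a k) ∈
        𝓐 (q k + if k = j then p else if k = j + 1 then p else 0) := by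
      intro k
      split_ifs
      · exact SetLike.mul_mem_graded (ha _) y.2
      · rw [add_comm]
        exact SetLike.mul_mem_graded x.2 (ha _)
      · rw [add_zero]
        exact ha _
    have := word_mem_chainGrading (S := S) n hb
    rw [Finset.sum_add_distrib, sum_range_junction h, add_zero] at this
    rwa [junction_word h]
  · have hb : ∀ k, (if k = j then (if k = 0 then x * a k else a k) * (y : A)
        else if k = 0 then x * a k else a k) ∈
        𝓐 (q k + ((if k = 0 then p else 0) + if k = j then p else 0)) := by
      have h0 : ∀ k, (if k = 0 then x * a k else a k) ∈ 𝓐 (q k + if k = 0 then p else 0) := by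
        intro k
        split_ifs
        · rw [add_comm]
          exact SetLike.mul_mem_graded x.2 (ha _)
        · rw [add_zero]
          exact ha _
      intro k
      rw [← add_assoc]
      by_cases h : k = j
      · rw [if_pos h, if_pos h]
        exact SetLike.mul_mem_graded (h0 k) y.2
      · rw [if_neg h, if_neg h, add_zero]
        exact h0 k
    have := word_mem_chainGrading (S := S) j hb
    rw [Finset.sum_add_distrib, Finset.sum_add_distrib, sum_range_zero, Finset.sum_ite_eq',
      if_pos (by simp), CharTwo.add_self_eq_zero, add_zero] at this
    rw [junction_last_word _ _ _ _ ha]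
    exact zsmul_mem this _

theorem iterJunction_mem_chainGrading {S : Superalgebra 𝓡 𝓐} {J : Type*} [Fintype J]
    {p : J → ZMod 2} (x y : ∀ t, 𝓐 (p t)) {n j : ℕ} (hj : j ≤ n + 1) {k : ZMod 2}
    {z : S.Chain n} (hz : z ∈ S.chainGrading n k) :
    S.iterJunction x y n j z ∈ S.chainGrading n k := by
  induction j generalizing z with
  | zero => exact hz
  | succ j ih =>
    refine ih (by omega) ?_
    rw [AddMonoidHom.finsetSum_apply]
    exact sum_mem fun t _ => junction_mem_chainGrading (by omega) _ _ hz

end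

end Superalgebra

/-- An identification of the superalgebra `A` with the corner `e L e` of the superalgebra `L`,
where `e` is the image of `1`. -/
structure CornerInclusion (S : Superalgebra 𝓡 𝓐) (T : Superalgebra 𝓡 𝓛) where
  /-- The inclusion of the corner. -/
  incl : A →+ L
  /-- The projection `l ↦ e l e` to the corner. -/
  retr : L →+ A
  incl_mul : ∀ a b, incl (a * b) = incl a * incl b
  incl_mem : ∀ ⦃i : ZMod 2⦄ ⦃a : A⦄, a ∈ 𝓐 i → incl a ∈ 𝓛 i
  incl_toRingHom : ∀ r, incl (S.toRingHom r) = T.toRingHom r * incl 1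
  retr_mem : ∀ ⦃i : ZMod 2⦄ ⦃l : L⦄, l ∈ 𝓛 i → retr l ∈ 𝓐 i
  retr_incl : ∀ a, retr (incl a) = a
  incl_retr : ∀ l, incl (retr l) = incl 1 * l * incl 1

namespace CornerInclusion

open Superalgebra

variable {S : Superalgebra 𝓡 𝓐} {T : Superalgebra 𝓡 𝓛} (c : CornerInclusion S T)

theorem incl_injective : Function.Injective c.incl :=
  Function.LeftInverse.injective c.retr_incl

theorem incl_mul_one (a : A) : c.incl a * c.incl 1 = c.incl a := by rw [← c.incl_mul, mul_one]

theorem one_mul_incl (a : A) : c.incl 1 * c.incl a = c.incl a := by rw [← c.incl_mul, one_mul]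

theorem incl_toRingHom_mul (r : R) (a : A) :
    c.incl (S.toRingHom r * a) = T.toRingHom r * c.incl a := by
  rw [c.incl_mul, c.incl_toRingHom, mul_assoc, one_mul_incl]

/-- The corner idempotent is even, so scalars commute with it without a sign. -/
theorem toRingHom_comm {i : ZMod 2} {r : R} (hr : r ∈ 𝓡 i) :
    T.toRingHom r * c.incl 1 = c.incl 1 * T.toRingHom r := by
  have h : ∀ i, superSign i 0 = 1 := by decide
  rw [T.supercentral hr (c.incl_mem (SetLike.one_mem_graded 𝓐)), h, one_smul]

theorem incl_mul_toRingHom {i : ZMod 2} {r : R} (hr : r ∈ 𝓡 i) (a : A) :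
    c.incl (a * S.toRingHom r) = c.incl a * T.toRingHom r := by
  rw [c.incl_mul, c.incl_toRingHom, c.toRingHom_comm hr, ← mul_assoc, incl_mul_one]

theorem retr_mul_toRingHom {i : ZMod 2} {r : R} (hr : r ∈ 𝓡 i) (l : L) :
    c.retr (l * T.toRingHom r) = c.retr l * S.toRingHom r := by
  apply c.incl_injective
  rw [c.incl_mul_toRingHom hr, c.incl_retr, c.incl_retr, mul_assoc, mul_assoc, mul_assoc,
    c.toRingHom_comm hr, mul_assoc]

theorem retr_toRingHom_mul {i : ZMod 2} {r : R} (hr : r ∈ 𝓡 i) (l : L) :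
    c.retr (T.toRingHom r * l) = S.toRingHom r * c.retr l := by
  apply c.incl_injective
  rw [c.incl_toRingHom_mul, c.incl_retr, c.incl_retr, ← mul_assoc, ← mul_assoc, ← mul_assoc,
    c.toRingHom_comm hr]

/-- The compression of a homogeneous element to the corner. -/
def retrHomogeneous {i : ZMod 2} (l : 𝓛 i) : 𝓐 i := ⟨c.retr l, c.retr_mem l.2⟩

/-- With `e` the image of `1`, the product of the compressions is `e y e e x e = e (y x) e`, and
these sum to `e`. Thus the compressed pairs satisfy the same identity inside the corner, and the
homotopy to the identity is available there too. -/
theorem sum_retr {J : Type*} [Fintype J] {p : J → ZMod 2} {x y : ∀ t, 𝓛 (p t)}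
    (hx : ∀ t, c.incl 1 * x t = x t) (hy : ∀ t, y t * c.incl 1 = (y t : L))
    (h : ∑ t, (y t : L) * x t = 1) :
    ∑ t, (c.retrHomogeneous (y t) : A) * c.retrHomogeneous (x t) = 1 := by
  apply c.incl_injective
  have e : ∀ t, c.incl ((c.retrHomogeneous (y t) : A) * c.retrHomogeneous (x t))
      = c.incl 1 * (y t * x t) * c.incl 1 := by
    intro t
    rw [c.incl_mul]
    simp only [retrHomogeneous]
    rw [c.incl_retr, c.incl_retr, hx, mul_assoc _ _ (c.incl 1), hy]
    simp only [mul_assoc]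
  rw [map_sum]
  simp only [e]
  rw [← Finset.sum_mul, ← Finset.mul_sum, h, mul_one, c.incl_mul_one]

variable [GradedRing 𝓡]

/-- The map induced by the inclusion on Hochschild chains. -/
def inclChain (n : ℕ) : S.Chain n →+ T.Chain n :=
  slotMap (fun _ => c.incl) fun _ _ _ r hr =>
    ⟨1, fun a => by rw [one_smul, c.incl_mul_toRingHom hr],
      fun a => by rw [one_smul, c.incl_toRingHom_mul]⟩

/-- The map induced by the projection on Hochschild chains. -/
def retrChain (n : ℕ) : T.Chain n →+ S.Chain n :=
  slotMap (fun _ => c.retr) fun _ _ _ r hr =>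
    ⟨1, fun a => by rw [one_smul, c.retr_mul_toRingHom hr],
      fun a => by rw [one_smul, c.retr_toRingHom_mul hr]⟩

theorem inclChain_word (n : ℕ) (a : ℕ → A) :
    c.inclChain n (S.word n a) = T.word n fun j => c.incl (a j) := slotMap_word _ _ _

theorem retrChain_word (n : ℕ) (a : ℕ → L) :
    c.retrChain n (T.word n a) = S.word n fun j => c.retr (a j) := slotMap_word _ _ _

/-- Compression is not assumed multiplicative, so this is a left inverse in each degree and not a
splitting of complexes. Its main use is the injectivity of `inclChain`, which lets identities in the
corner be checked in `L`. -/
theorem retrChain_inclChain (n : ℕ) (z : S.Chain n) : c.retrChain n (c.inclChain n z) = z := by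
  refine DFunLike.congr_fun (f := (c.retrChain n).comp (c.inclChain n)) (g := AddMonoidHom.id _)
    (chain_hom_ext fun a q ha => ?_) z
  rw [AddMonoidHom.comp_apply, inclChain_word, retrChain_word]
  exact word_congr fun j _ => c.retr_incl _

theorem inclChain_injective (n : ℕ) : Function.Injective (c.inclChain n) :=
  Function.LeftInverse.injective (c.retrChain_inclChain n)

theorem inclChain_smul {n : ℕ} (r : R) (z : S.Chain n) :
    c.inclChain n (r • z) = r • c.inclChain n z := by
  refine DFunLike.congr_fun
    (f := (c.inclChain n).comp (DistribSMul.toAddMonoidHom (S.Chain n) r))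
    (g := (DistribSMul.toAddMonoidHom (T.Chain n) r).comp (c.inclChain n))
    (chain_hom_ext fun a q ha => ?_) z
  simp only [AddMonoidHom.comp_apply, DistribSMul.toAddMonoidHom_apply, inclChain_word]
  refine (congrArg (c.inclChain n) (S.smul_chainMk r _)).trans
    (Eq.trans ?_ (T.smul_chainMk r _).symm)
  have e : S.chainMk (Function.update (fun j : Fin (n + 1) => a j) 0 (S.toRingHom r * a 0))
      = S.word n (Function.update a 0 (S.toRingHom r * a 0)) := by
    refine congrArg S.chainMk (funext fun j => ?_)
    rcases eq_or_ne j 0 with rfl | hj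
    · simp
    · rw [Function.update_of_ne hj, Function.update_of_ne (by simpa using hj)]
  refine (congrArg (c.inclChain n) e).trans ((c.inclChain_word n _).trans ?_)
  refine congrArg T.chainMk (funext fun j => ?_)
  rcases eq_or_ne j 0 with rfl | hj
  · simp [c.incl_toRingHom_mul]
  · simp [hj]

theorem faceHom_inclChain {n i : ℕ} (hi : i ≤ n + 1) (z : S.Chain (n + 1)) :
    T.faceHom n i (c.inclChain (n + 1) z) = c.inclChain n (S.faceHom n i z) := by
  refine DFunLike.congr_fun (f := (T.faceHom n i).comp (c.inclChain (n + 1)))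
    (g := (c.inclChain n).comp (S.faceHom n i)) (chain_hom_ext fun a q ha => ?_) z
  rw [AddMonoidHom.comp_apply, AddMonoidHom.comp_apply, inclChain_word]
  rcases Nat.lt_or_ge n i with h | h
  · obtain rfl : i = n + 1 := by omega
    rw [faceHom_last_word _ _ ha, faceHom_last_word _ _ fun j => c.incl_mem (ha j), map_zsmul,
      inclChain_word]
    refine word_smul_congr rfl fun k _ => ?_
    split_ifs
    exacts [(c.incl_mul _ _).symm, rfl]
  · rw [faceHom_word h, faceHom_word h, inclChain_word]
    refine word_congr fun k _ => ?_
    split_ifs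
    exacts [rfl, (c.incl_mul _ _).symm, rfl]

theorem d_inclChain {n : ℕ} (z : S.Chain (n + 1)) :
    T.d n (c.inclChain (n + 1) z) = c.inclChain n (S.d n z) := by
  rw [d_eq_sum_faceHom, d_eq_sum_faceHom, map_sum]
  refine Finset.sum_congr rfl fun i hi => ?_
  rw [c.faceHom_inclChain (Nat.lt_succ_iff.1 (Finset.mem_range.1 hi)), map_zsmul]

theorem inclChain_mem_chainGrading {n : ℕ} {k : ZMod 2} {z : S.Chain n}
    (hz : z ∈ S.chainGrading n k) : c.inclChain n z ∈ T.chainGrading n k := by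
  refine map_mem_chainGrading _ (fun a q ha => ?_) hz
  rw [inclChain_word]
  exact word_mem_chainGrading n fun j => c.incl_mem (ha j)

theorem retrChain_mem_chainGrading {n : ℕ} {k : ZMod 2} {z : T.Chain n}
    (hz : z ∈ T.chainGrading n k) : c.retrChain n z ∈ S.chainGrading n k := by
  refine map_mem_chainGrading _ (fun a q ha => ?_) hz
  rw [retrChain_word]
  exact word_mem_chainGrading n fun j => c.retr_mem (ha j)

/-- The Hochschild chain map of a corner inclusion. -/
def inclLinear (n : ℕ) : S.Chain n →ₗ[R] T.Chain n where
  __ := c.inclChain n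
  map_smul' := c.inclChain_smul

theorem inclLinear_mem_cycles {n : ℕ} {z : S.Chain n} (hz : z ∈ S.cycles n) :
    c.inclLinear n z ∈ T.cycles n := by
  cases n with
  | zero => trivial
  | succ n =>
    have hz' : S.d n z = 0 := hz
    refine (c.d_inclChain z).trans ?_
    rw [hz', map_zero]

/-- The map induced by a corner inclusion on Hochschild homology. -/
def homologyMap (n : ℕ) : S.Homology n →ₗ[R] T.Homology n :=
  Submodule.mapQ _ _ ((c.inclLinear n).restrict fun _ => c.inclLinear_mem_cycles) (by
    rintro ⟨z, hz⟩ ⟨v, hv⟩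
    refine ⟨c.inclChain (n + 1) v, ?_⟩
    rw [d_inclChain, hv]
    rfl)

/-! ### Full corners: the trace map and the isomorphism on homology. -/

section Full

variable {J : Type*} {p : J → ZMod 2} {x y : ∀ t, 𝓛 (p t)}

/-- Next to an element of the corner, `e x e` and `e y e` act as `x` and `y`: one `e` is absorbed by
the pair and the other by that element. -/
theorem inclChain_junction (hx : ∀ t, c.incl 1 * x t = x t)
    (hy : ∀ t, y t * c.incl 1 = (y t : L)) {n j : ℕ} (hj : j ≤ n) (t : J) (z : S.Chain n) :
    c.inclChain n (S.junction n j (c.retrHomogeneous (x t)) (c.retrHomogeneous (y t)) z)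
      = T.junction n j (x t) (y t) (c.inclChain n z) := by
  refine DFunLike.congr_fun
    (f := (c.inclChain n).comp
      (S.junction n j (c.retrHomogeneous (x t)) (c.retrHomogeneous (y t))))
    (g := (T.junction n j (x t) (y t)).comp (c.inclChain n)) (chain_hom_ext fun a q ha => ?_) z
  have h1 : ∀ b, c.incl ((c.retrHomogeneous (x t) : A) * b) = x t * c.incl b := by
    intro b
    rw [c.incl_mul, retrHomogeneous, c.incl_retr, hx, mul_assoc, c.one_mul_incl]
  have h2 : ∀ b, c.incl (b * (c.retrHomogeneous (y t) : A)) = c.incl b * y t := by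
    intro b
    rw [c.incl_mul, retrHomogeneous, c.incl_retr, mul_assoc, hy, ← mul_assoc, c.incl_mul_one]
  rw [AddMonoidHom.comp_apply, AddMonoidHom.comp_apply, inclChain_word]
  rcases hj.lt_or_eq with h | rfl
  · rw [junction_word h, junction_word h, inclChain_word]
    refine word_congr fun k _ => ?_
    split_ifs
    exacts [h2 _, h1 _, rfl]
  · rw [junction_last_word _ _ _ _ ha, junction_last_word _ _ _ _ fun j => c.incl_mem (ha j),
      map_zsmul, inclChain_word]
    refine word_smul_congr rfl fun k _ => ?_
    split_ifs
    · rw [h2, h1]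
    · rw [h2]
    · rw [h1]
    · rfl

variable [Fintype J]

theorem inclChain_iterJunction (hx : ∀ t, c.incl 1 * x t = x t)
    (hy : ∀ t, y t * c.incl 1 = (y t : L)) {n k : ℕ} (hk : k ≤ n + 1) (z : S.Chain n) :
    c.inclChain n (S.iterJunction (fun t => c.retrHomogeneous (x t))
      (fun t => c.retrHomogeneous (y t)) n k z) = T.iterJunction x y n k (c.inclChain n z) := by
  induction k generalizing z with
  | zero => rfl
  | succ k ih =>
    simp only [iterJunction, AddMonoidHom.comp_apply]
    rw [ih (by omega), AddMonoidHom.finsetSum_apply, AddMonoidHom.finsetSum_apply, map_sum]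
    congr 1
    exact Finset.sum_congr rfl fun t _ => c.inclChain_junction hx hy (by omega) t z

/-- Junctions are applied from the last gap down to gap `0`. The hypotheses record which sides of
the entries are already fixed by `e` when gaps `0, …, k - 1` remain: the next junction fixes one
more entry on the right by `y` and its successor on the left by `x`. When none remains, every entry
is in the corner, where compression does nothing. -/
theorem inclChain_retrChain_iterJunction_word (hx : ∀ t, c.incl 1 * x t = x t)
    (hy : ∀ t, y t * c.incl 1 = (y t : L)) {n k : ℕ} (hk : k ≤ n) (a : ℕ → L)
    (h0 : c.incl 1 * a 0 = a 0) (hl : ∀ j, k < j → j ≤ n → c.incl 1 * a j = a j)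
    (hr : ∀ j, k ≤ j → j ≤ n → a j * c.incl 1 = a j) :
    c.inclChain n (c.retrChain n (T.iterJunction x y n k (T.word n a)))
      = T.iterJunction x y n k (T.word n a) := by
  induction k generalizing a with
  | zero =>
    simp only [iterJunction, AddMonoidHom.id_apply]
    rw [retrChain_word, inclChain_word]
    refine word_congr fun j hj => ?_
    rw [c.incl_retr, mul_assoc, hr j (Nat.zero_le j) hj]
    rcases Nat.eq_zero_or_pos j with rfl | h
    exacts [h0, hl j h hj]
  | succ k ih =>
    rw [iterJunction, AddMonoidHom.comp_apply, AddMonoidHom.finsetSum_apply, map_sum, map_sum,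
      map_sum]
    refine Finset.sum_congr rfl fun t _ => ?_
    rw [junction_word hk]
    refine ih (by omega) _ ?_ (fun j h1 h2 => ?_) (fun j h1 h2 => ?_)
    · rw [if_neg (Nat.succ_ne_zero k).symm]
      split_ifs with h
      · rw [← mul_assoc, h0]
      · exact h0
    · rw [if_neg (by omega)]
      split_ifs with h
      · rw [← mul_assoc, hx]
      · exact hl j (by omega) h2
    · split_ifs with h h'
      · rw [mul_assoc, hy]
      · rw [mul_assoc, hr j (by omega) h2]
      · exact hr j (by omega) h2

theorem inclChain_retrChain_iterJunction (hx : ∀ t, c.incl 1 * x t = x t)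
    (hy : ∀ t, y t * c.incl 1 = (y t : L)) (n : ℕ) (z : T.Chain n) :
    c.inclChain n (c.retrChain n (T.iterJunction x y n (n + 1) z))
      = T.iterJunction x y n (n + 1) z := by
  refine DFunLike.congr_fun
    (f := ((c.inclChain n).comp (c.retrChain n)).comp (T.iterJunction x y n (n + 1)))
    (g := T.iterJunction x y n (n + 1)) (chain_hom_ext fun a q ha => ?_) z
  rw [AddMonoidHom.comp_apply, AddMonoidHom.comp_apply, iterJunction, AddMonoidHom.comp_apply,
    AddMonoidHom.finsetSum_apply, map_sum, map_sum, map_sum]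
  refine Finset.sum_congr rfl fun t _ => ?_
  rw [junction_last_word _ _ _ _ ha]
  simp only [map_zsmul]
  congr 1
  -- The cyclic junction comes first and starts the induction: `x` fixes entry `0` on the left and
  -- `y` fixes entry `n` on the right.
  refine c.inclChain_retrChain_iterJunction_word hx hy le_rfl _ ?_ (fun j h1 h2 => ?_)
    (fun j h1 h2 => ?_)
  · rw [if_pos rfl]
    split_ifs
    · rw [← mul_assoc, ← mul_assoc, hx]
    · rw [← mul_assoc, hx]
  · omega
  · rw [if_pos (by omega), mul_assoc, hy]

/-- The homotopy inverse of the chain map of a full corner inclusion. -/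
def traceChain (x y : ∀ t, 𝓛 (p t)) (n : ℕ) : T.Chain n →+ S.Chain n :=
  (c.retrChain n).comp (T.iterJunction x y n (n + 1))

theorem inclChain_traceChain (hx : ∀ t, c.incl 1 * x t = x t)
    (hy : ∀ t, y t * c.incl 1 = (y t : L)) {n : ℕ} (z : T.Chain n) :
    c.inclChain n (c.traceChain x y n z) = T.iterJunction x y n (n + 1) z :=
  c.inclChain_retrChain_iterJunction hx hy n z

/-- After the injective inclusion into the chains of `L`, this becomes the compatibility of the full
junction operator with the differential. -/
theorem d_traceChain (hx : ∀ t, c.incl 1 * x t = x t) (hy : ∀ t, y t * c.incl 1 = (y t : L))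
    (h : ∑ t, (y t : L) * x t = 1) {n : ℕ} (z : T.Chain (n + 1)) :
    S.d n (c.traceChain x y (n + 1) z) = c.traceChain x y n (T.d n z) := by
  apply c.inclChain_injective
  rw [← d_inclChain, c.inclChain_traceChain hx hy, c.inclChain_traceChain hx hy, d_iterJunction h]

theorem traceChain_mem_cycles (hx : ∀ t, c.incl 1 * x t = x t)
    (hy : ∀ t, y t * c.incl 1 = (y t : L)) (h : ∑ t, (y t : L) * x t = 1) {n : ℕ}
    {z : T.Chain n} (hz : z ∈ T.cycles n) : c.traceChain x y n z ∈ S.cycles n := by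
  cases n with
  | zero => trivial
  | succ n =>
    have hz' : T.d n z = 0 := hz
    refine (c.d_traceChain hx hy h z).trans ?_
    rw [hz', map_zero]

theorem homologyMap_traceChain (hx : ∀ t, c.incl 1 * x t = x t)
    (hy : ∀ t, y t * c.incl 1 = (y t : L)) (h : ∑ t, (y t : L) * x t = 1) {n : ℕ}
    {z : T.Chain n} (hz : z ∈ T.cycles n) :
    c.homologyMap n (Submodule.Quotient.mk ⟨_, c.traceChain_mem_cycles hx hy h hz⟩)
      = Submodule.Quotient.mk ⟨z, hz⟩ := by
  symm
  refine (Submodule.Quotient.eq _).2 ?_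
  change z - c.inclChain n (c.traceChain x y n z) ∈ T.boundaries n
  rw [c.inclChain_traceChain hx hy]
  exact sub_iterJunction_mem_boundaries h hz

/-- If `w` becomes a boundary `d v` in `L`, the full junction operator of the corner sends `w` to
`d` of the trace of `v`. By the homotopy inside the corner, `w` differs from that by a boundary. -/
theorem homologyMap_injective (hx : ∀ t, c.incl 1 * x t = x t)
    (hy : ∀ t, y t * c.incl 1 = (y t : L)) (h : ∑ t, (y t : L) * x t = 1) (n : ℕ) :
    Function.Injective (c.homologyMap n) := by
  rw [injective_iff_map_eq_zero]
  intro u hu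
  obtain ⟨⟨w, hw⟩, rfl⟩ := Submodule.mkQ_surjective _ u
  have hu' : (⟨c.inclChain n w, c.inclLinear_mem_cycles hw⟩ : T.cycles n) ∈
    (T.boundaries n).submoduleOf (T.cycles n) := (Submodule.Quotient.mk_eq_zero _).1 hu
  obtain ⟨v, hv⟩ : c.inclChain n w ∈ T.boundaries n := hu'
  refine (Submodule.Quotient.mk_eq_zero _).2 ?_
  change w ∈ S.boundaries n
  have h1 := sub_iterJunction_mem_boundaries (c.sum_retr hx hy h) hw
  have h2 : S.iterJunction (fun t => c.retrHomogeneous (x t))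
      (fun t => c.retrHomogeneous (y t)) n (n + 1) w = S.d n (c.traceChain x y (n + 1) v) := by
    apply c.inclChain_injective
    rw [c.inclChain_iterJunction hx hy le_rfl, c.d_traceChain hx hy h,
      c.inclChain_traceChain hx hy, hv]
  rw [h2] at h1
  exact (Submodule.sub_mem_iff_left _ (LinearMap.mem_range_self _ _)).1 h1

/-- The inclusion of a full corner induces an isomorphism on Hochschild homology. -/
theorem exists_homology_equiv (hx : ∀ t, c.incl 1 * x t = x t)
    (hy : ∀ t, y t * c.incl 1 = (y t : L)) (h : ∑ t, (y t : L) * x t = 1) (n : ℕ) :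
    ∃ e : S.Homology n ≃ₗ[R] T.Homology n, ∀ (k : ZMod 2) (u : S.Homology n),
      u ∈ S.homologyGrading n k ↔ e u ∈ T.homologyGrading n k := by
  have hinj := c.homologyMap_injective hx hy h n
  refine ⟨LinearEquiv.ofBijective (c.homologyMap n) ⟨hinj, fun u => ?_⟩, fun k u => ⟨?_, ?_⟩⟩
  · obtain ⟨⟨z, hz⟩, rfl⟩ := Submodule.mkQ_surjective _ u
    exact ⟨_, c.homologyMap_traceChain hx hy h hz⟩
  · rintro ⟨w, hw, rfl⟩
    exact ⟨⟨_, c.inclLinear_mem_cycles w.2⟩, c.inclChain_mem_chainGrading hw, rfl⟩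
  · rintro ⟨⟨z, hz⟩, hz', hu⟩
    -- The trace of a homogeneous representative is again homogeneous, and by injectivity it
    -- represents `u`. Thus the inverse preserves parity as well.
    have e : u = Submodule.Quotient.mk ⟨_, c.traceChain_mem_cycles hx hy h hz⟩ :=
      hinj (hu.symm.trans (c.homologyMap_traceChain hx hy h hz).symm)
    rw [e]
    exact ⟨⟨_, c.traceChain_mem_cycles hx hy h hz⟩,
      c.retrChain_mem_chainGrading (iterJunction_mem_chainGrading x y le_rfl hz'), rfl⟩

end Full

end CornerInclusion

end Corner

/-! ### Morita contexts -/

section Morita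

variable {R : Type*} [Ring R] {𝓡 : ZMod 2 → AddSubgroup R}
  {A : Type*} [Ring A] {𝓐 : ZMod 2 → AddSubgroup A} [GradedRing 𝓐]
  {B : Type*} [Ring B] {𝓑 : ZMod 2 → AddSubgroup B} [GradedRing 𝓑]
  {SA : Superalgebra 𝓡 𝓐} {SB : Superalgebra 𝓡 𝓑}

/-- A biadditive pairing represents `1` by finitely many pairs of homogeneous elements of equal
parity. -/
def IsFullPairing {M N C : Type*} [AddCommGroup M] [AddCommGroup N] [Ring C]
    (𝓜 : ZMod 2 → AddSubgroup M) (𝓝 : ZMod 2 → AddSubgroup N) (φ : M →+ N →+ C) : Prop :=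
  ∃ (J : Type) (_ : Fintype J) (d : J → ZMod 2) (u : ∀ t, 𝓜 (d t)) (v : ∀ t, 𝓝 (d t)),
    ∑ t, φ (u t) (v t) = 1

/-- A Morita context: even bimodule pairings `P ⊗_B Q → A` and `Q ⊗_A P → B` which are
associative with each other. -/
structure MoritaContext (P : SuperBimodule.{w₁} SA SB) (Q : SuperBimodule.{w₂} SB SA) where
  /-- The pairing with values in `A`. -/
  φ : P.carrier →+ Q.carrier →+ A
  /-- The pairing with values in `B`. -/
  ψ : Q.carrier →+ P.carrier →+ B
  φ_smul : ∀ (a : A) (p : P.carrier) (q : Q.carrier), φ (a • p) q = a * φ p q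
  φ_op_smul : ∀ (a : A) (p : P.carrier) (q : Q.carrier), φ p (op a • q) = φ p q * a
  φ_balanced : ∀ (b : B) (p : P.carrier) (q : Q.carrier), φ (op b • p) q = φ p (b • q)
  φ_mem : ∀ ⦃i j : ZMod 2⦄ ⦃p : P.carrier⦄ ⦃q : Q.carrier⦄, p ∈ P.grading i → q ∈ Q.grading j →
    φ p q ∈ 𝓐 (i + j)
  ψ_smul : ∀ (b : B) (q : Q.carrier) (p : P.carrier), ψ (b • q) p = b * ψ q p
  ψ_op_smul : ∀ (b : B) (q : Q.carrier) (p : P.carrier), ψ q (op b • p) = ψ q p * b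
  ψ_balanced : ∀ (a : A) (q : Q.carrier) (p : P.carrier), ψ (op a • q) p = ψ q (a • p)
  ψ_mem : ∀ ⦃i j : ZMod 2⦄ ⦃q : Q.carrier⦄ ⦃p : P.carrier⦄, q ∈ Q.grading i → p ∈ P.grading j →
    ψ q p ∈ 𝓑 (i + j)
  φ_smul_eq : ∀ (p p' : P.carrier) (q : Q.carrier), φ p q • p' = op (ψ q p') • p
  ψ_smul_eq : ∀ (q q' : Q.carrier) (p : P.carrier), ψ q p • q' = op (φ p q') • q
  φ_full : IsFullPairing P.grading Q.grading φ
  ψ_full : IsFullPairing Q.grading P.grading ψ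

/-! ### Pairings attached to the given isomorphisms. -/

namespace SuperBimodule.Iso

variable {P : SuperBimodule.{w₁} SA SB} {Q : SuperBimodule.{w₂} SB SA}

/-- The pairing attached to an isomorphism `P ⊗_B Q ≅ A`. -/
def pairing (f : (P.tensor Q).Iso (regular SA)) : P.carrier →+ Q.carrier →+ A :=
  AddMonoidHom.mk' (fun p => AddMonoidHom.mk' (fun q => f.toAddEquiv (tmul P Q p q))
    fun q q' => by rw [tmul_add, map_add]) fun p p' => by
      ext q
      exact (congrArg f.toAddEquiv (add_tmul p p' q)).trans (map_add f.toAddEquiv _ _)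

variable (f : (P.tensor Q).Iso (regular SA)) (g : (Q.tensor P).Iso (regular SB))

theorem pairing_apply (p : P.carrier) (q : Q.carrier) :
    f.pairing p q = f.toAddEquiv (tmul P Q p q) := rfl

theorem pairing_smul (a : A) (p : P.carrier) (q : Q.carrier) :
    f.pairing (a • p) q = a * f.pairing p q := f.map_smul a (tmul P Q p q)

theorem pairing_op_smul (a : A) (p : P.carrier) (q : Q.carrier) :
    f.pairing p (op a • q) = f.pairing p q * a := f.map_op_smul a (tmul P Q p q)

theorem pairing_balanced (b : B) (p : P.carrier) (q : Q.carrier) :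
    f.pairing (op b • p) q = f.pairing p (b • q) := congrArg f.toAddEquiv (op_smul_tmul_eq p b q)

theorem pairing_mem {i j : ZMod 2} {p : P.carrier} {q : Q.carrier} (hp : p ∈ P.grading i)
    (hq : q ∈ Q.grading j) : f.pairing p q ∈ 𝓐 (i + j) :=
  f.map_mem (tmul_mem P Q hp hq rfl)

/-- Write the preimage of `1` as a sum of tensors and split these into homogeneous parts. Since `1`
is even, only products of elements of equal parity are needed; the induction therefore follows the
even part of the image of an arbitrary tensor. -/
theorem pairing_full : IsFullPairing P.grading Q.grading f.pairing := by
  have key : ∀ z : TensorCarrier P Q, ∃ (J : Type) (_ : Fintype J) (d : J → ZMod 2)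
      (u : ∀ t, P.grading (d t)) (v : ∀ t, Q.grading (d t)),
      ∑ t, f.pairing (u t) (v t) = GradedRing.proj 𝓐 0 (f.toAddEquiv z) := by
    intro z
    induction z using tensor_induction with
    | zero => exact ⟨Empty, inferInstance, Empty.elim, fun t => t.elim, fun t => t.elim, by simp⟩
    | add z z' hz hz' =>
      obtain ⟨J, _, d, u, v, h⟩ := hz
      obtain ⟨J', _, d', u', v', h'⟩ := hz'
      refine ⟨J ⊕ J', inferInstance, Sum.elim d d', Sum.rec u u', Sum.rec v v', ?_⟩
      rw [Fintype.sum_sum_type, map_add, map_add, ← h, ← h']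
    | tmul p q =>
      refine ⟨ZMod 2, inferInstance, id, fun t => ⟨P.proj t p, P.proj_mem t p⟩,
        fun t => ⟨Q.proj t q, Q.proj_mem t q⟩, ?_⟩
      rw [← pairing_apply]
      conv_rhs => rw [← P.sum_proj p, ← Q.sum_proj q]
      rw [map_sum f.pairing, AddMonoidHom.finsetSum_apply, map_sum]
      refine Finset.sum_congr rfl fun i _ => ?_
      rw [map_sum, map_sum, Finset.sum_eq_single i]
      · rw [gradedRing_proj_of_mem _ (f.pairing_mem (P.proj_mem i p) (Q.proj_mem i q)), if_pos]
        rw [CharTwo.add_self_eq_zero]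
      · intro j _ hj
        have hij : ∀ i j : ZMod 2, 0 = i + j → j = i := by decide
        rw [gradedRing_proj_of_mem _ (f.pairing_mem (P.proj_mem i p) (Q.proj_mem j q)),
          if_neg fun h => hj (hij i j h)]
      · simp
  obtain ⟨J, _, d, u, v, h⟩ := key (f.toAddEquiv.symm (1 : A))
  refine ⟨J, inferInstance, d, u, v, h.trans ?_⟩
  rw [AddEquiv.apply_symm_apply]
  exact (gradedRing_proj_of_mem 0 (SetLike.one_mem_graded 𝓐)).trans (if_pos rfl)

include f in
-- As `g` is injective, `q ⊗ e = 0` for every `q`. Applying the balanced map `q ⊗ p' ↦ f(p, q) p'`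
-- gives `f(p, q) e = 0`, and the elements `f(p, q)` generate `1`.
theorem eq_zero_of_pairing_eq_zero {e : P.carrier} (h : ∀ q, g.pairing q e = 0) : e = 0 := by
  obtain ⟨J, _, d, u, v, h1⟩ := f.pairing_full
  have h2 : ∀ (p : P.carrier) (q : Q.carrier), f.pairing p q • e = 0 := by
    intro p q
    let T : TensorCarrier Q P →+ P.carrier := tensorLift
      (AddMonoidHom.mk' (fun q => AddMonoidHom.mk' (fun p' => f.pairing p q • p') (smul_add _))
        fun q q' => by ext p'; simp [add_smul])
      fun q a p' => by
        change f.pairing p (op a • q) • p' = f.pairing p q • a • p'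
        rw [pairing_op_smul, mul_smul]
    have h3 : tmul Q P q e = 0 :=
      g.toAddEquiv.injective ((h q).trans (map_zero g.toAddEquiv).symm)
    exact (congrArg T h3).trans (map_zero T)
  rw [← one_smul A e, ← h1, Finset.sum_smul]
  exact Finset.sum_eq_zero fun t _ => h2 _ _

/-- The map `id ⊗ θ` on `Q ⊗_A P ≅ B` is left `B`-linear, so it is right multiplication by its value
at `1`. -/
theorem pairing_map_eq {J : Type*} [Fintype J] {u : J → Q.carrier} {v : J → P.carrier}
    (h : ∑ t, g.pairing (u t) (v t) = 1) (θ : P.carrier →+ P.carrier)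
    (hθ : ∀ (a : A) (p : P.carrier), θ (a • p) = a • θ p) (q : Q.carrier) (p : P.carrier) :
    g.pairing q (θ p) = g.pairing q p * ∑ t, g.pairing (u t) (θ (v t)) := by
  let T : TensorCarrier Q P →+ B := tensorLift
    (AddMonoidHom.mk' (fun q => (g.pairing q).comp θ) fun q q' => by ext p'; simp)
    fun q a p' => by
      change g.pairing (op a • q) (θ p') = g.pairing q (θ (a • p'))
      rw [pairing_balanced, hθ]
  have hT : ∀ (b : B) (z : TensorCarrier Q P), T (b • z) = b * T z := by
    intro b z
    induction z using tensor_induction with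
    | zero => rw [smul_zero, map_zero, mul_zero]
    | add z z' hz hz' => rw [smul_add, map_add, hz, hz', map_add, mul_add]
    | tmul q p => exact g.pairing_smul b q (θ p)
  have h2 : tmul Q P q p = g.pairing q p • ∑ t, tmul Q P (u t) (v t) := by
    apply g.toAddEquiv.injective
    refine Eq.trans ?_ (g.map_smul _ _).symm
    rw [map_sum]
    change g.pairing q p = g.pairing q p * ∑ t, g.pairing (u t) (v t)
    rw [h, mul_one]
  have h3 := congrArg T h2
  rw [hT, map_sum] at h3
  exact h3

end SuperBimodule.Iso

open SuperBimodule in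
/-- Morita equivalent superalgebras are related by a Morita context. -/
theorem SuperMoritaEquivalent.exists_moritaContext
    (h : SuperMoritaEquivalent.{w₁, w₂} SA SB) :
    ∃ (P : SuperBimodule.{w₁} SA SB) (Q : SuperBimodule.{w₂} SB SA),
      Nonempty (MoritaContext P Q) := by
  obtain ⟨P, Q, ⟨f⟩, ⟨g⟩⟩ := h
  obtain ⟨J, _, d, u, v, h1⟩ := g.pairing_full
  obtain ⟨J', _, d', u', v', h2⟩ := f.pairing_full
  -- Associativity asks that `p ↦ f(p, q) p'` be right multiplication by `ψ(q, p')`. This map is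
  -- `A`-linear, so `pairing_map_eq` leaves only one candidate, its value at `1 = ∑ g(u_t, v_t)`.
  let ψ : Q.carrier →+ P.carrier →+ B := AddMonoidHom.mk' (fun q => AddMonoidHom.mk'
    (fun p => ∑ t, g.pairing (u t) (f.pairing (v t) q • p))
    fun p p' => by simp only [smul_add, map_add, Finset.sum_add_distrib])
    fun q q' => by
      ext p
      simp only [map_add, add_smul, Finset.sum_add_distrib, AddMonoidHom.mk'_apply,
        AddMonoidHom.add_apply]
  have hψ : ∀ q p, ψ q p = ∑ t, g.pairing (u t) (f.pairing (v t) q • p) := fun _ _ => rfl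
  have key : ∀ (p p' : P.carrier) (q : Q.carrier), f.pairing p q • p' = op (ψ q p') • p := by
    intro p p' q
    rw [← sub_eq_zero]
    refine Iso.eq_zero_of_pairing_eq_zero f g fun q₁ => ?_
    have := g.pairing_map_eq h1 (AddMonoidHom.mk' (fun p => f.pairing p q • p')
      fun p₁ p₂ => by simp only [map_add, AddMonoidHom.add_apply, add_smul])
      (fun a p => by simp [f.pairing_smul, mul_smul]) q₁ p
    rw [map_sub, g.pairing_op_smul, sub_eq_zero]
    exact this
  -- The element `b` is recovered from its action as `∑ g(u_t, v_t b)`. Identities for `ψ` can then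
  -- be checked on `P`, where `key` turns them into identities for `f`.
  have faithful : ∀ b b' : B, (∀ p : P.carrier, op b • p = op b' • p) → b = b' := by
    intro b b' hb
    have h3 : ∀ c : B, c = ∑ t, g.pairing (u t) (op c • (v t : P.carrier)) := by
      intro c
      simp only [g.pairing_op_smul, ← Finset.sum_mul, h1, one_mul]
    rw [h3 b, h3 b']
    simp only [hb]
  have ψ_smul : ∀ (b : B) (q : Q.carrier) (p : P.carrier), ψ (b • q) p = b * ψ q p :=
    fun b q p => faithful _ _ fun p' => by
      rw [← key, op_mul, mul_smul, ← key, f.pairing_balanced]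
  have ψ_op_smul : ∀ (b : B) (q : Q.carrier) (p : P.carrier), ψ q (op b • p) = ψ q p * b :=
    fun b q p => faithful _ _ fun p' => by
      rw [← key, op_mul, mul_smul, ← key, smul_comm]
  refine ⟨P, Q, ⟨{
    φ := f.pairing
    ψ := ψ
    φ_smul := f.pairing_smul
    φ_op_smul := f.pairing_op_smul
    φ_balanced := f.pairing_balanced
    φ_mem := fun _ _ _ _ => f.pairing_mem
    ψ_smul := ψ_smul
    ψ_op_smul := ψ_op_smul
    ψ_balanced := fun a q p => faithful _ _ fun p' => by
      rw [← key, ← key, f.pairing_op_smul, mul_smul]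
    ψ_mem := fun i j q p hq hp => by
      rw [hψ]
      refine sum_mem fun t _ => ?_
      have := g.pairing_mem (u t).2 (P.smul_mem (f.pairing_mem (v t).2 hq) hp)
      rwa [← add_assoc, ← add_assoc, CharTwo.add_self_eq_zero, zero_add] at this
    φ_smul_eq := key
    ψ_smul_eq := fun q q' p => by
      rw [← sub_eq_zero]
      -- The second associativity law follows from the first: paired with `p₁`, both sides become
      -- `f(p₁, q) f(p, q')`.
      refine Iso.eq_zero_of_pairing_eq_zero g f fun p₁ => ?_
      rw [map_sub, f.pairing_op_smul, ← f.pairing_balanced, ← key, f.pairing_smul, sub_self]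
    φ_full := ⟨J', inferInstance, d', u', v', h2⟩
    ψ_full := ?_ }⟩⟩
  -- Insert `1 = ∑ f(u', v')` into `1 = ∑ g(u, v)`. Then `g(u, f(u', v') v) = g(u, u') ψ(v', v) =
  -- ψ(g(u, u') v', v)`, and the parity of `u'` and `v'` cancels.
  refine ⟨J × J', inferInstance, fun t => d t.1,
    fun t => ⟨g.pairing (u t.1) (u' t.2) • (v' t.2 : Q.carrier), ?_⟩, fun t => v t.1, ?_⟩
  · have := Q.smul_mem (g.pairing_mem (u t.1).2 (u' t.2).2) (v' t.2).2
    rwa [add_assoc, CharTwo.add_self_eq_zero, add_zero] at this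
  · rw [Fintype.sum_prod_type, ← h1]
    refine Finset.sum_congr rfl fun t _ => ?_
    conv_rhs => rw [← one_smul A (v t : P.carrier), ← h2, Finset.sum_smul, map_sum]
    refine Finset.sum_congr rfl fun t' _ => ?_
    rw [key, g.pairing_op_smul, ψ_smul]

end Morita

/-! ### The linking superalgebra of a Morita context -/

section Linking

variable {R : Type*} [Ring R] {𝓡 : ZMod 2 → AddSubgroup R}
  {A : Type*} [Ring A] {𝓐 : ZMod 2 → AddSubgroup A} [GradedRing 𝓐]
  {B : Type*} [Ring B] {𝓑 : ZMod 2 → AddSubgroup B} [GradedRing 𝓑]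
  {SA : Superalgebra 𝓡 𝓐} {SB : Superalgebra 𝓡 𝓑}
  {P : SuperBimodule.{w₁} SA SB} {Q : SuperBimodule.{w₂} SB SA}

namespace MoritaContext

/-- The matrices with rows `(a, p)` and `(q, b)`. -/
@[ext]
structure Linking (M : MoritaContext P Q) where
  /-- The upper left entry. -/
  a : A
  /-- The upper right entry. -/
  p : P.carrier
  /-- The lower left entry. -/
  q : Q.carrier
  /-- The lower right entry. -/
  b : B

variable (M : MoritaContext P Q)

namespace Linking

/-- The entries of a matrix. -/
def equivProd : M.Linking ≃ A × P.carrier × Q.carrier × B where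
  toFun x := (x.a, x.p, x.q, x.b)
  invFun x := ⟨x.1, x.2.1, x.2.2.1, x.2.2.2⟩
  left_inv _ := rfl
  right_inv _ := rfl

instance addCommGroup : AddCommGroup M.Linking := (equivProd M).addCommGroup

instance : Mul M.Linking :=
  ⟨fun x y => ⟨x.a * y.a + M.φ x.p y.q, x.a • y.p + op y.b • x.p, op y.a • x.q + x.b • y.q,
    M.ψ x.q y.p + x.b * y.b⟩⟩

instance : One M.Linking := ⟨⟨1, 0, 0, 1⟩⟩

variable {M}

@[simp] theorem add_a (x y : M.Linking) : (x + y).a = x.a + y.a := rfl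
@[simp] theorem add_p (x y : M.Linking) : (x + y).p = x.p + y.p := rfl
@[simp] theorem add_q (x y : M.Linking) : (x + y).q = x.q + y.q := rfl
@[simp] theorem add_b (x y : M.Linking) : (x + y).b = x.b + y.b := rfl
@[simp] theorem zero_a : (0 : M.Linking).a = 0 := rfl
@[simp] theorem zero_p : (0 : M.Linking).p = 0 := rfl
@[simp] theorem zero_q : (0 : M.Linking).q = 0 := rfl
@[simp] theorem zero_b : (0 : M.Linking).b = 0 := rfl
@[simp] theorem one_a : (1 : M.Linking).a = 1 := rfl
@[simp] theorem one_p : (1 : M.Linking).p = 0 := rfl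
@[simp] theorem one_q : (1 : M.Linking).q = 0 := rfl
@[simp] theorem one_b : (1 : M.Linking).b = 1 := rfl
@[simp] theorem mul_a (x y : M.Linking) : (x * y).a = x.a * y.a + M.φ x.p y.q := rfl
@[simp] theorem mul_p (x y : M.Linking) : (x * y).p = x.a • y.p + op y.b • x.p := rfl
@[simp] theorem mul_q (x y : M.Linking) : (x * y).q = op y.a • x.q + x.b • y.q := rfl
@[simp] theorem mul_b (x y : M.Linking) : (x * y).b = M.ψ x.q y.p + x.b * y.b := rfl

/-- In the associativity law, the diagonal entries use linearity and balancedness of the pairings.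
The off-diagonal ones use the two mutual associativity laws of the context. -/
instance : Ring M.Linking where
  __ := addCommGroup M
  left_distrib x y z := by
    ext <;> simp [mul_add, add_smul] <;> abel
  right_distrib x y z := by
    ext <;> simp [add_mul, add_smul] <;> abel
  zero_mul x := by ext <;> simp
  mul_zero x := by ext <;> simp
  one_mul x := by ext <;> simp
  mul_one x := by ext <;> simp
  mul_assoc x y z := by
    ext
    · simp [add_mul, mul_add, M.φ_smul, M.φ_op_smul, M.φ_balanced, mul_assoc]
      abel
    · simp only [mul_p, mul_a, mul_b, add_smul, smul_add, mul_smul, op_add, op_mul, M.φ_smul_eq,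
        smul_comm (x.a) (op z.b)]
      abel
    · simp only [mul_q, mul_a, mul_b, add_smul, smul_add, mul_smul, op_add, op_mul, M.ψ_smul_eq,
        smul_comm (x.b) (op z.a)]
      abel
    · simp [add_mul, mul_add, M.ψ_smul, M.ψ_op_smul, M.ψ_balanced, mul_assoc]
      abel

variable (M)

/-- The homogeneous parts of the linking algebra. -/
def grading (i : ZMod 2) : AddSubgroup M.Linking where
  carrier := {x | x.a ∈ 𝓐 i ∧ x.p ∈ P.grading i ∧ x.q ∈ Q.grading i ∧ x.b ∈ 𝓑 i}
  zero_mem' := ⟨zero_mem _, zero_mem _, zero_mem _, zero_mem _⟩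
  add_mem' hx hy := ⟨add_mem hx.1 hy.1, add_mem hx.2.1 hy.2.1, add_mem hx.2.2.1 hy.2.2.1,
    add_mem hx.2.2.2 hy.2.2.2⟩
  neg_mem' hx := ⟨neg_mem hx.1, neg_mem hx.2.1, neg_mem hx.2.2.1, neg_mem hx.2.2.2⟩

/-- The additive inclusion of the upper left entry. -/
def inclA : A →+ M.Linking := AddMonoidHom.mk' (⟨·, 0, 0, 0⟩) fun a a' => by ext <;> simp

/-- The additive inclusion of the upper right entry. -/
def inclP : P.carrier →+ M.Linking := AddMonoidHom.mk' (⟨0, ·, 0, 0⟩) fun a a' => by ext <;> simp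

/-- The additive inclusion of the lower left entry. -/
def inclQ : Q.carrier →+ M.Linking := AddMonoidHom.mk' (⟨0, 0, ·, 0⟩) fun a a' => by ext <;> simp

/-- The additive inclusion of the lower right entry. -/
def inclB : B →+ M.Linking := AddMonoidHom.mk' (⟨0, 0, 0, ·⟩) fun a a' => by ext <;> simp

/-- The upper left entry. -/
def entryA : M.Linking →+ A := AddMonoidHom.mk' (fun x => x.a) fun _ _ => rfl

/-- The upper right entry. -/
def entryP : M.Linking →+ P.carrier := AddMonoidHom.mk' (fun x => x.p) fun _ _ => rfl

/-- The lower left entry. -/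
def entryQ : M.Linking →+ Q.carrier := AddMonoidHom.mk' (fun x => x.q) fun _ _ => rfl

/-- The lower right entry. -/
def entryB : M.Linking →+ B := AddMonoidHom.mk' (fun x => x.b) fun _ _ => rfl

theorem entryA_apply (x : M.Linking) : entryA M x = x.a := rfl

theorem entryB_apply (x : M.Linking) : entryB M x = x.b := rfl

/-- The projection of the linking algebra to its part of parity `k`. -/
def proj (k : ZMod 2) : M.Linking →+ M.Linking :=
  AddMonoidHom.mk' (fun x => ⟨GradedRing.proj 𝓐 k x.a, P.proj k x.p, Q.proj k x.q,
    GradedRing.proj 𝓑 k x.b⟩) fun x y => by ext <;> simp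

instance : GradedRing (grading M) where
  one_mem := ⟨SetLike.one_mem_graded 𝓐, zero_mem _, zero_mem _, SetLike.one_mem_graded 𝓑⟩
  mul_mem i j x y hx hy := ⟨
    add_mem (SetLike.mul_mem_graded hx.1 hy.1) (M.φ_mem hx.2.1 hy.2.2.1),
    add_mem (P.smul_mem hx.1 hy.2.1) (P.op_smul_mem hx.2.1 hy.2.2.2),
    add_mem (Q.op_smul_mem hx.2.2.1 hy.1) (Q.smul_mem hx.2.2.2 hy.2.2.1),
    add_mem (M.ψ_mem hx.2.2.1 hy.2.1) (SetLike.mul_mem_graded hx.2.2.2 hy.2.2.2)⟩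
  toDecomposition := (isInternal_of_proj (grading M) (proj M)
    (fun k x => ⟨SetLike.coe_mem _, P.proj_mem k _, Q.proj_mem k _, SetLike.coe_mem _⟩)
    (fun x => by
      ext
      · exact (map_sum (entryA M) (fun k => proj M k x) Finset.univ).trans (sum_gradedRing_proj x.a)
      · exact (map_sum (entryP M) (fun k => proj M k x) Finset.univ).trans (P.sum_proj x.p)
      · exact (map_sum (entryQ M) (fun k => proj M k x) Finset.univ).trans (Q.sum_proj x.q)
      · exact (map_sum (entryB M) (fun k => proj M k x) Finset.univ).trans (sum_gradedRing_proj x.b))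
    (fun j k x hx => by
      have h1 := gradedRing_proj_of_mem k hx.1
      have h2 := P.proj_of_mem k hx.2.1
      have h3 := Q.proj_of_mem k hx.2.2.1
      have h4 := gradedRing_proj_of_mem k hx.2.2.2
      split_ifs at h1 h2 h3 h4 ⊢
      all_goals ext <;> assumption)).chooseDecomposition

/-- The linking superalgebra of a Morita context. -/
def superalgebra : Superalgebra 𝓡 (grading M) where
  toRingHom :=
    { toFun := fun r => ⟨SA.toRingHom r, 0, 0, SB.toRingHom r⟩
      map_one' := by ext <;> simp
      map_zero' := by ext <;> simp
      map_mul' := fun r s => by ext <;> simp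
      map_add' := fun r s => by ext <;> simp }
  map_mem i r hr := ⟨SA.map_mem hr, zero_mem _, zero_mem _, SB.map_mem hr⟩
  supercentral i j r x hr hx := by
    -- The additive structure is transported from the product, so signs can be compared entry by
    -- entry. Off the diagonal, supercentrality is the compatibility of the two scalar actions on
    -- `P` and `Q`.
    rw [← (equivProd M).injective.eq_iff]
    have e : ∀ (n : ℤ) (x : M.Linking), equivProd M (n • x) = n • equivProd M x :=
      fun _ _ => rfl
    rw [e]
    refine Prod.ext ?_ (Prod.ext ?_ (Prod.ext ?_ ?_))
    · simpa [equivProd] using SA.supercentral hr hx.1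
    · simpa [equivProd] using P.base_smul hr hx.2.1
    · simpa [equivProd] using Q.base_smul hr hx.2.2.1
    · simpa [equivProd] using SB.supercentral hr hx.2.2.2

/-- The upper left corner of the linking superalgebra. -/
def cornerA : CornerInclusion SA (superalgebra M) where
  incl := inclA M
  retr := entryA M
  incl_mul a a' := by ext <;> simp [inclA]
  incl_mem i a ha := ⟨ha, zero_mem _, zero_mem _, zero_mem _⟩
  incl_toRingHom r := by ext <;> simp [inclA, superalgebra]
  retr_mem i l hl := hl.1
  retr_incl a := rfl
  incl_retr l := by ext <;> simp [inclA, entryA_apply]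

/-- The lower right corner of the linking superalgebra. -/
def cornerB : CornerInclusion SB (superalgebra M) where
  incl := inclB M
  retr := entryB M
  incl_mul a a' := by ext <;> simp [inclB]
  incl_mem i a ha := ⟨zero_mem _, zero_mem _, zero_mem _, ha⟩
  incl_toRingHom r := by ext <;> simp [inclB, superalgebra]
  retr_mem i l hl := hl.2.2.2
  retr_incl a := rfl
  incl_retr l := by ext <;> simp [inclB, entryB_apply]

theorem inclQ_mul_inclP (q : Q.carrier) (p : P.carrier) :
    inclQ M q * inclP M p = inclB M (M.ψ q p) := by
  ext <;> simp [inclQ, inclP, inclB]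

theorem inclP_mul_inclQ (p : P.carrier) (q : Q.carrier) :
    inclP M p * inclQ M q = inclA M (M.φ p q) := by
  ext <;> simp [inclQ, inclP, inclA]

/-! ### Fullness of the two corners. -/

variable [GradedRing 𝓡]

theorem exists_homology_equiv_cornerA (n : ℕ) :
    ∃ e : SA.Homology n ≃ₗ[R] (superalgebra M).Homology n, ∀ (k : ZMod 2) (u : SA.Homology n),
      u ∈ SA.homologyGrading n k ↔ e u ∈ (superalgebra M).homologyGrading n k := by
  obtain ⟨J, _, d, u, v, h⟩ := M.ψ_full
  have h1 : inclA M 1 ∈ grading M 0 := (cornerA M).incl_mem (SetLike.one_mem_graded 𝓐)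
  -- The unit of the linking algebra is the sum of the two diagonal idempotents. The index `none`
  -- supplies that of `A` as its own square; the other indices supply that of `B` as `∑ ψ(u_t,
  -- v_t)`, with the factors placed off the diagonal.
  refine (cornerA M).exists_homology_equiv (J := Option J) (p := fun t => t.elim 0 d)
    (x := fun t => match t with
      | none => ⟨inclA M 1, h1⟩
      | some t => ⟨inclP M (v t), zero_mem _, (v t).2, zero_mem _, zero_mem _⟩)
    (y := fun t => match t with
      | none => ⟨inclA M 1, h1⟩
      | some t => ⟨inclQ M (u t), zero_mem _, zero_mem _, (u t).2, zero_mem _⟩)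
    ?_ ?_ ?_ n
  · rintro (_ | t) <;> ext <;> simp [cornerA, inclA, inclP]
  · rintro (_ | t) <;> ext <;> simp [cornerA, inclA, inclQ]
  · rw [Fintype.sum_option]
    simp only [inclQ_mul_inclP]
    rw [← map_sum, h]
    ext <;> simp [inclA, inclB]

theorem exists_homology_equiv_cornerB (n : ℕ) :
    ∃ e : SB.Homology n ≃ₗ[R] (superalgebra M).Homology n, ∀ (k : ZMod 2) (u : SB.Homology n),
      u ∈ SB.homologyGrading n k ↔ e u ∈ (superalgebra M).homologyGrading n k := by
  obtain ⟨J, _, d, u, v, h⟩ := M.φ_full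
  have h1 : inclB M 1 ∈ grading M 0 := (cornerB M).incl_mem (SetLike.one_mem_graded 𝓑)
  refine (cornerB M).exists_homology_equiv (J := Option J) (p := fun t => t.elim 0 d)
    (x := fun t => match t with
      | none => ⟨inclB M 1, h1⟩
      | some t => ⟨inclQ M (v t), zero_mem _, zero_mem _, (v t).2, zero_mem _⟩)
    (y := fun t => match t with
      | none => ⟨inclB M 1, h1⟩
      | some t => ⟨inclP M (u t), zero_mem _, (u t).2, zero_mem _, zero_mem _⟩)
    ?_ ?_ ?_ n
  · rintro (_ | t) <;> ext <;> simp [cornerB, inclB, inclQ]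
  · rintro (_ | t) <;> ext <;> simp [cornerB, inclB, inclP]
  · rw [Fintype.sum_option]
    simp only [inclP_mul_inclQ]
    rw [← map_sum, h]
    ext <;> simp [inclA, inclB]

end Linking

end MoritaContext

end Linking

end

theorem mainTheorem2 {R : Type*} [Ring R] (𝓡 : ZMod 2 → AddSubgroup R) [GradedRing 𝓡]
    (hR : IsSupercommutative 𝓡)
    {A : Type*} [Ring A] (𝓐 : ZMod 2 → AddSubgroup A) [GradedRing 𝓐]
    {B : Type*} [Ring B] (𝓑 : ZMod 2 → AddSubgroup B) [GradedRing 𝓑]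
    (SA : Superalgebra 𝓡 𝓐) (SB : Superalgebra 𝓡 𝓑)
    (h : SuperMoritaEquivalent.{w₁, w₂} SA SB) (n : ℕ) :
    ∃ e : SA.Homology n ≃ₗ[R] SB.Homology n,
      ∀ (k : ZMod 2) (x : SA.Homology n),
        x ∈ SA.homologyGrading n k ↔ e x ∈ SB.homologyGrading n k := by
  obtain ⟨P, Q, ⟨M⟩⟩ := h.exists_moritaContext
  obtain ⟨e, he⟩ := MoritaContext.Linking.exists_homology_equiv_cornerA M n
  obtain ⟨f, hf⟩ := MoritaContext.Linking.exists_homology_equiv_cornerB M n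
  refine ⟨e.trans f.symm, fun k x => ?_⟩
  rw [he, hf, LinearEquiv.trans_apply, LinearEquiv.apply_symm_apply]
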